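/- All graphs are finite and loopless, with multiple edges allowed, and $m$ is a positive integer. A factor of $G$ is a spanning subgraph of $G$. A graph is $m$-tree-connected if it has $m$ pairwise edge-disjoint spanning trees (so the graph without vertices is not $m$-tree-connected). The $m$-tree-connected components of a graph are its maximal induced $m$-tree-connected subgraphs; their vertex sets partition the vertex set. Put $\Omega_m(G)=m|P|-e_G(P)$, where $P$ is this partition of $V(G)$ and $e_G(P)$ is the number of edges of $G$ joining different parts of $P$ (so $\Omega_m=0$ for the graph without vertices). For a subgraph $C$ of $F$, $d_F(C)$ is the number of edges of $F$ with exactly one end in $V(C)$. As usual, $d_F(v)$ is the degree of $v$ in $F$, $G[S]$ is the subgraph induced by $S$, and $G\setminus S$ is obtained from $G$ by deleting the vertices of $S$. **Theorem.** Let $G$ be a graph with at least one vertex, let $F$ be a factor of $G$, and let $h$ be a nonnegative integer-valued function on $V(G)$. Let $c\in[2,\infty)$ be a real number and let $\xi:V(G)\to[0,m]$ be a real function such that, for every $m$-tree-connected component $C$ of $F$, $$\sum_{v\in V(C)}\xi(v)\ \ge\ m-\frac{m}{c-1}\big(|V(C)|-1\big)-\frac12 d_F(C).$$ If for all $S\subseteq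 V(G)$, $$\Omega_m(G\setminus S)<\sum_{v\in S}\Big(h(v)-\frac{m}{c-1}-\xi(v)\Big)+m+1+\frac{1}{c-1}\Omega_m(G[S])-\frac{c-2}{c-1}\min\Big\{\Big\lfloor\sum_{v\in S}\frac{h(v)}{2}\Big\rfloor,\ m|S|-\Omega_m(G[S])\Big\},$$ then $G$ has an $m$-tree-connected factor $H$ containing $F$ such that $d_H(v)\le h(v)+d_F(v)$ for each vertex $v$. -/

import Mathlib

open Graph

namespace Graph

variable {α β : Type*}

/-- A multigraph is a tree when it has no loops and no parallel edges, and its underlying simple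
graph is a tree (nonempty, connected and acyclic). -/
def IsTreeGraph (T : Graph α β) : Prop :=
  T.Simple ∧ T.toSimpleGraph.IsTree

/-- `G` is `m`-tree-connected: it has `m` pairwise edge-disjoint spanning trees. -/
def IsTreeConnected (G : Graph α β) (m : ℕ) : Prop :=
  ∃ T : Fin m → Graph α β,
    (∀ i, T i ≤s G ∧ (T i).IsTreeGraph) ∧ Pairwise fun i j => Disjoint E(T i) E(T j)

/-- The vertex sets of the `m`-tree-connected components of `G`: the maximal vertex sets that
induce an `m`-tree-connected subgraph. -/
def treeComponents (G : Graph α β) (m : ℕ) : Set (Set α) :=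
  {A | Maximal (fun X : Set α => X ⊆ V(G) ∧ (G.induce X).IsTreeConnected m) A}

/-- The edges of `G` whose ends lie in different members of the family `P` of vertex sets. -/
def crossingEdges (G : Graph α β) (P : Set (Set α)) : Set β :=
  {e | ∃ x y, G.IsLink e x y ∧ ∃ A ∈ P, ∃ B ∈ P, A ≠ B ∧ x ∈ A ∧ y ∈ B}

/-- `Ω_m(G) = m |P| - e_G(P)`, with `P` the partition of the vertex set into the vertex sets of the
`m`-tree-connected components. -/
noncomputable def Omega (G : Graph α β) (m : ℕ) : ℤ :=
  (m : ℤ) * ((G.treeComponents m).ncard : ℤ)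
    - ((G.crossingEdges (G.treeComponents m)).ncard : ℤ)

/-- The degree of `v` in a loopless multigraph: the number of edges incident to `v`. -/
noncomputable def vertexDegree (G : Graph α β) (v : α) : ℕ :=
  (G.incidenceSet v).ncard

/-- The number of edges of `G` with exactly one end in `A`. -/
noncomputable def boundaryDegree (G : Graph α β) (A : Set α) : ℕ :=
  {e | ∃ x y, G.IsLink e x y ∧ x ∈ A ∧ y ∉ A}.ncard

end Graph

/-! Call an edge set sparse if every nonempty vertex set X induces at most m(|X|-1) of its members,
and X tight if equality holds. Sparse sets are the independent sets of a matroid, and by matroid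
partition a nonempty graph is m-tree-connected exactly when it has a sparse set of m(|V|-1) edges.
The m-tree-connected components are then the maximal tight sets of any basis, and Ω_m is m|V| minus
the rank (`treeComponents_eq`, `omega_eq`).

Fix a basis F₀ of F and a largest sparse I ⊇ F₀ whose edges outside F₀ respect h. If |I| = m(|V|-1),
then E(F) ∪ I is the required factor. Otherwise an exchange argument
(`IsAdmissible.exists_saturated`) gives a set S on which h is attained, such that the core J,
consisting of F₀ and the edges of I avoiding S, spans all edges of G \ S.

Let b count the edges of I \ F₀ inside S, and let Q be the family of maximal J-tight sets inside S,
which are components of F. Then Σ_S h ≤ |I| - |J| + b by saturation, m|V| - |J| ≤ Ω(G \ S) + Σ_Q (m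
- d_F(C)/2) by counting along the tight sets of J, and Ω(G[S]) + m Σ_Q (|C|-1) + b ≤ m|S| by
sparsity. The hypothesis on ξ bounds the sum over Q; the third estimate divided by c-1 removes Σ_Q
(|C|-1) and leaves (c-2)/(c-1) times b, where b is at most both terms of the minimum. Together with
|I| ≤ m|V| - m - 1 this contradicts the assumption at S. -/

namespace Graph

/-! ### Sparse edge sets and tight vertex sets. -/

variable {α β : Type*} {G H : Graph α β} {k l : ℕ} {I J : Set β} {X Y : Set α} {e : β} {x y v : α}

/-- A graph with finitely many vertices and finitely many edges. -/
class FiniteGraph (G : Graph α β) : Prop where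
  vertexSet_finite : V(G).Finite
  edgeSet_finite : E(G).Finite

lemma FiniteGraph.of_le [G.FiniteGraph] (h : H ≤ G) : H.FiniteGraph :=
  ⟨FiniteGraph.vertexSet_finite.subset h.vertexSet_mono,
    FiniteGraph.edgeSet_finite.subset h.edgeSet_mono⟩

lemma finite_of_subset_vertexSet [G.FiniteGraph] (h : X ⊆ V(G)) : X.Finite :=
  FiniteGraph.vertexSet_finite.subset h

lemma finite_of_subset_edgeSet [G.FiniteGraph] (h : I ⊆ E(G)) : I.Finite :=
  FiniteGraph.edgeSet_finite.subset h

/-- The edges of `G` with both ends in `X`. -/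
def edgesIn (G : Graph α β) (X : Set α) : Set β := {e | ∃ x y, G.IsLink e x y ∧ x ∈ X ∧ y ∈ X}

lemma edgesIn_subset (G : Graph α β) (X : Set α) : G.edgesIn X ⊆ E(G) := by
  rintro e ⟨x, y, h, -⟩
  exact h.edge_mem

lemma edgesIn_mono (h : X ⊆ Y) : G.edgesIn X ⊆ G.edgesIn Y := by
  rintro e ⟨x, y, hl, hx, hy⟩
  exact ⟨x, y, hl, h hx, h hy⟩

lemma IsLink.mem_edgesIn_iff (h : G.IsLink e x y) : e ∈ G.edgesIn X ↔ x ∈ X ∧ y ∈ X := by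
  refine ⟨?_, fun h' ↦ ⟨x, y, h, h'⟩⟩
  rintro ⟨u, v, hl, hu, hv⟩
  obtain ⟨rfl, rfl⟩ | ⟨rfl, rfl⟩ := h.eq_and_eq_or_eq_and_eq hl
  · exact ⟨hu, hv⟩
  · exact ⟨hv, hu⟩

lemma edgesIn_inter (G : Graph α β) (X Y : Set α) :
    G.edgesIn (X ∩ Y) = G.edgesIn X ∩ G.edgesIn Y := by
  ext e
  constructor
  · exact fun h ↦ ⟨edgesIn_mono Set.inter_subset_left h, edgesIn_mono Set.inter_subset_right h⟩
  · rintro ⟨⟨x, y, hl, hx, hy⟩, h⟩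
    rw [hl.mem_edgesIn_iff] at h
    exact ⟨x, y, hl, ⟨hx, h.1⟩, hy, h.2⟩

lemma edgesIn_disjoint (h : Disjoint X Y) : Disjoint (G.edgesIn X) (G.edgesIn Y) := by
  rw [Set.disjoint_left]
  rintro e ⟨x, y, hl, hx, hy⟩ h'
  exact Set.disjoint_left.1 h hx (hl.mem_edgesIn_iff.1 h').1

@[simp] lemma edgesIn_vertexSet (G : Graph α β) : G.edgesIn V(G) = E(G) := by
  refine (edgesIn_subset _ _).antisymm fun e he ↦ ?_
  obtain ⟨x, y, h⟩ := exists_isLink_of_mem_edgeSet he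
  exact ⟨x, y, h, h.left_mem, h.right_mem⟩

lemma edgesIn_of_le (h : H ≤ G) (X : Set α) : H.edgesIn X = G.edgesIn X ∩ E(H) := by
  ext e
  constructor
  · rintro ⟨x, y, hl, hx, hy⟩
    exact ⟨⟨x, y, hl.mono h, hx, hy⟩, hl.edge_mem⟩
  · rintro ⟨⟨x, y, hl, hx, hy⟩, he⟩
    exact ⟨x, y, (h.isLink_iff he).2 hl, hx, hy⟩

/-- A set of edges is `k`-sparse when every nonempty vertex set `X` induces at most `k(|X| - 1)` of
its members. -/
structure IsSparse (G : Graph α β) (k : ℕ) (I : Set β) : Prop where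
  subset : I ⊆ E(G)
  le : ∀ X ⊆ V(G), X.Nonempty → (I ∩ G.edgesIn X).ncard + k ≤ k * X.ncard

/-- A nonempty vertex set `X` is `k`-tight for a set of edges when it induces exactly `k(|X| - 1)`
of its members. -/
structure IsTight (G : Graph α β) (k : ℕ) (I : Set β) (X : Set α) : Prop where
  subset : X ⊆ V(G)
  nonempty : X.Nonempty
  eq : (I ∩ G.edgesIn X).ncard + k = k * X.ncard

lemma isSparse_empty [G.FiniteGraph] : G.IsSparse k ∅ := by
  refine ⟨Set.empty_subset _, fun X hX hne ↦ ?_⟩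
  have := (Set.ncard_pos (finite_of_subset_vertexSet hX)).2 hne
  simpa using Nat.le_mul_of_pos_right k this

lemma IsSparse.mono [G.FiniteGraph] (hJ : G.IsSparse k J) (h : I ⊆ J) : G.IsSparse k I := by
  refine ⟨h.trans hJ.subset, fun X hX hne ↦ le_trans ?_ (hJ.le X hX hne)⟩
  gcongr
  exact (finite_of_subset_edgeSet hJ.subset).inter_of_left _

lemma IsSparse.finite [G.FiniteGraph] (hI : G.IsSparse k I) : I.Finite :=
  finite_of_subset_edgeSet hI.subset

lemma IsSparse.ncard_add_le [G.FiniteGraph] (hI : G.IsSparse k I) (h : V(G).Nonempty) :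
    I.ncard + k ≤ k * V(G).ncard := by
  simpa [Set.inter_eq_self_of_subset_left hI.subset] using hI.le V(G) subset_rfl h

lemma IsTight.finite [G.FiniteGraph] (h : G.IsTight k I X) : X.Finite :=
  finite_of_subset_vertexSet h.subset

lemma IsTight.mono [G.FiniteGraph] (hX : G.IsTight k I X) (hJ : G.IsSparse k J) (h : I ⊆ J) :
    G.IsTight k J X := by
  refine ⟨hX.subset, hX.nonempty, (hJ.le X hX.subset hX.nonempty).antisymm ?_⟩
  rw [← hX.eq]
  gcongr
  exact hJ.finite.inter_of_left _

lemma IsTight.inter_eq_of_subset [G.FiniteGraph] (hI : G.IsTight k I X) (hJ : G.IsTight k J X)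
    (hfin : J.Finite) (h : I ⊆ J) : I ∩ G.edgesIn X = J ∩ G.edgesIn X := by
  refine Set.eq_of_subset_of_ncard_le (Set.inter_subset_inter_left _ h) ?_ (hfin.inter_of_left _)
  have := hI.eq
  have := hJ.eq
  omega

lemma isTight_singleton [G.FiniteGraph] (hI : G.IsSparse k I) (hx : x ∈ V(G)) :
    G.IsTight k I {x} := by
  refine ⟨by simpa, by simp, ?_⟩
  have := hI.le {x} (by simpa) (by simp)
  simp only [Set.ncard_singleton, mul_one] at this ⊢
  omega

/-- Induced edge counts are supermodular and vertex counts modular. The sets must meet because the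
sparsity bound is available only for a nonempty intersection. -/
lemma IsTight.union [G.FiniteGraph] (hI : G.IsSparse k I) (hX : G.IsTight k I X)
    (hY : G.IsTight k I Y) (h : (X ∩ Y).Nonempty) : G.IsTight k I (X ∪ Y) := by
  have hs : X ∪ Y ⊆ V(G) := Set.union_subset hX.subset hY.subset
  have hne : (X ∪ Y).Nonempty := hX.nonempty.inl
  refine ⟨hs, hne, (hI.le _ hs hne).antisymm ?_⟩
  have h1 := hI.le (X ∩ Y) (Set.inter_subset_left.trans hX.subset) h
  have h2 := Set.ncard_union_add_ncard_inter X Y hX.finite hY.finite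
  have h3 := Set.ncard_union_add_ncard_inter (I ∩ G.edgesIn X) (I ∩ G.edgesIn Y)
    (hI.finite.inter_of_left _) (hI.finite.inter_of_left _)
  have h4 : (I ∩ G.edgesIn X ∪ I ∩ G.edgesIn Y).ncard ≤ (I ∩ G.edgesIn (X ∪ Y)).ncard := by
    refine Set.ncard_le_ncard ?_ (hI.finite.inter_of_left _)
    rw [← Set.inter_union_distrib_left]
    exact Set.inter_subset_inter_right _ (Set.union_subset (edgesIn_mono Set.subset_union_left)
      (edgesIn_mono Set.subset_union_right))
  rw [← Set.inter_inter_distrib_left, ← edgesIn_inter] at h3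
  have h5 : k * (X ∪ Y).ncard + k * (X ∩ Y).ncard = k * X.ncard + k * Y.ncard := by
    rw [← mul_add, ← mul_add, h2]
  have := hX.eq
  have := hY.eq
  linarith

/-- One more edge raises each count by at most one, so only a set already at its bound can obstruct
the insertion. -/
lemma isSparse_insert_iff [G.FiniteGraph] (hI : G.IsSparse k I) (he : e ∈ E(G)) (heI : e ∉ I) :
    G.IsSparse k (insert e I) ↔ ∀ X, G.IsTight k I X → e ∉ G.edgesIn X := by
  have hc (X) (hX : e ∈ G.edgesIn X) :
      (insert e I ∩ G.edgesIn X).ncard = (I ∩ G.edgesIn X).ncard + 1 := by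
    rw [Set.insert_inter_of_mem hX,
      Set.ncard_insert_of_notMem (fun h ↦ heI h.1) (hI.finite.inter_of_left _)]
  constructor
  · intro h X hX heX
    have h1 := h.le X hX.subset hX.nonempty
    rw [hc X heX] at h1
    have := hX.eq
    omega
  · refine fun h ↦ ⟨Set.insert_subset he hI.subset, fun X hX hne ↦ ?_⟩
    have h1 := hI.le X hX hne
    by_cases heX : e ∈ G.edgesIn X
    · have h2 : (I ∩ G.edgesIn X).ncard + k ≠ k * X.ncard := fun h' ↦ h X ⟨hX, hne, h'⟩ heX
      rw [hc X heX]
      omega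
    · rwa [Set.insert_inter_of_notMem heX]

/-! ### Vertex partitions and the partition into maximal tight sets. -/

/-- A partition of the vertex set, as a finite set of blocks. -/
structure IsVertexPartition (G : Graph α β) (P : Finset (Set α)) : Prop where
  subset : ∀ X ∈ P, X ⊆ V(G)
  nonempty : ∀ X ∈ P, X.Nonempty
  disjoint : (P : Set (Set α)).PairwiseDisjoint id
  cover : ∀ x ∈ V(G), ∃ X ∈ P, x ∈ X

lemma ncard_biUnion_finset {ι γ : Type*} (P : Finset ι) (f : ι → Set γ)
    (hf : ∀ i ∈ P, (f i).Finite) (h : (P : Set ι).PairwiseDisjoint f) :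
    (⋃ i ∈ P, f i).ncard = ∑ i ∈ P, (f i).ncard := by
  exact (P.finite_toSet.ncard_biUnion (s := f) hf h).trans (finsum_mem_coe_finset _ _)

namespace IsVertexPartition

variable {P : Finset (Set α)}

lemma eq_of_mem (hP : G.IsVertexPartition P) (hX : X ∈ P) (hY : Y ∈ P) (hx : x ∈ X)
    (hy : x ∈ Y) : X = Y := by
  by_contra hne
  exact Set.disjoint_left.1 (hP.disjoint hX hY hne) hx hy

lemma mem_crossingEdges_iff (hP : G.IsVertexPartition P) (he : e ∈ E(G)) :
    e ∈ G.crossingEdges P ↔ ∀ X ∈ P, e ∉ G.edgesIn X := by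
  constructor
  · rintro ⟨x, y, hl, A, hA, B, hB, hne, hx, hy⟩ X hX heX
    rw [hl.mem_edgesIn_iff] at heX
    exact hne ((hP.eq_of_mem hA hX hx heX.1).trans (hP.eq_of_mem hX hB heX.2 hy))
  · intro h
    obtain ⟨x, y, hl⟩ := exists_isLink_of_mem_edgeSet he
    obtain ⟨A, hA, hx⟩ := hP.cover x hl.left_mem
    obtain ⟨B, hB, hy⟩ := hP.cover y hl.right_mem
    refine ⟨x, y, hl, A, hA, B, hB, ?_, hx, hy⟩
    rintro rfl
    exact h A hA ⟨x, y, hl, hx, hy⟩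

lemma sum_ncard_inter [G.FiniteGraph] (hP : G.IsVertexPartition P) (hY : Y ⊆ V(G)) :
    ∑ X ∈ P, (X ∩ Y).ncard = Y.ncard := by
  rw [← ncard_biUnion_finset]
  · congr 1
    ext x
    simp only [Set.mem_iUnion, Set.mem_inter_iff, exists_prop]
    exact ⟨fun ⟨_, _, _, h⟩ ↦ h, fun h ↦ (hP.cover x (hY h)).imp fun X hX ↦ ⟨hX.1, hX.2, h⟩⟩
  · exact fun X hX ↦ (finite_of_subset_vertexSet (hP.subset X hX)).inter_of_left _
  · exact fun X hX Z hZ hne ↦ (hP.disjoint hX hZ hne).mono Set.inter_subset_left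
      Set.inter_subset_left

lemma sum_ncard [G.FiniteGraph] (hP : G.IsVertexPartition P) :
    ∑ X ∈ P, X.ncard = V(G).ncard := by
  rw [← hP.sum_ncard_inter subset_rfl]
  exact Finset.sum_congr rfl fun X hX ↦ by
    rw [Set.inter_eq_self_of_subset_left (hP.subset X hX)]

lemma ncard_eq_sum_add [G.FiniteGraph] (hP : G.IsVertexPartition P) (hJ : J ⊆ E(G)) :
    J.ncard = ∑ X ∈ P, (J ∩ G.edgesIn X).ncard + (J ∩ G.crossingEdges P).ncard := by
  have hfin := finite_of_subset_edgeSet hJ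
  rw [← ncard_biUnion_finset _ _ (fun X _ ↦ hfin.inter_of_left _), ← Set.ncard_union_eq ?_ ?_
    (hfin.inter_of_left _)]
  · congr 1
    ext e
    simp only [Set.mem_union, Set.mem_iUnion, Set.mem_inter_iff, exists_prop]
    refine ⟨fun he ↦ ?_, ?_⟩
    · by_cases h : e ∈ G.crossingEdges P
      · exact Or.inr ⟨he, h⟩
      · rw [hP.mem_crossingEdges_iff (hJ he)] at h
        push Not at h
        obtain ⟨X, hX, hX'⟩ := h
        exact Or.inl ⟨X, hX, he, hX'⟩
    · rintro (⟨X, -, he, -⟩ | ⟨he, -⟩) <;> exact he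
  · rw [Set.disjoint_left]
    intro e he he'
    simp only [Set.mem_iUnion, exists_prop] at he
    obtain ⟨X, hX, he1, he2⟩ := he
    exact (hP.mem_crossingEdges_iff (hJ he1)).1 he'.2 X hX he2
  · exact hfin.subset (by simp)
  · exact fun X hX Z hZ hne ↦ (edgesIn_disjoint (hP.disjoint hX hZ hne)).mono
      Set.inter_subset_right Set.inter_subset_right

end IsVertexPartition

lemma finite_setOf_maximal_isTight (G : Graph α β) [G.FiniteGraph] (k : ℕ) (I : Set β) :
    {X | Maximal (G.IsTight k I) X}.Finite :=
  FiniteGraph.vertexSet_finite.finite_subsets.subset fun _ hX ↦ hX.prop.subset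

/-- The maximal `k`-tight vertex sets of a set of edges. -/
noncomputable def tightParts (G : Graph α β) [G.FiniteGraph] (k : ℕ) (I : Set β) :
    Finset (Set α) :=
  (finite_setOf_maximal_isTight G k I).toFinset

lemma mem_tightParts [G.FiniteGraph] :
    X ∈ G.tightParts k I ↔ Maximal (G.IsTight k I) X := by
  simp [tightParts]

lemma IsTight.exists_mem_tightParts [G.FiniteGraph] (hX : G.IsTight k I X) :
    ∃ Y ∈ G.tightParts k I, X ⊆ Y := by
  have hfin : {X | G.IsTight k I X}.Finite :=
    FiniteGraph.vertexSet_finite.finite_subsets.subset fun _ hX ↦ hX.subset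
  obtain ⟨Y, hXY, hY⟩ := hfin.exists_le_maximal hX
  exact ⟨Y, mem_tightParts.2 hY, hXY⟩

lemma isVertexPartition_tightParts [G.FiniteGraph] (hI : G.IsSparse k I) :
    G.IsVertexPartition (G.tightParts k I) := by
  refine ⟨fun X hX ↦ (mem_tightParts.1 hX).prop.subset,
    fun X hX ↦ (mem_tightParts.1 hX).prop.nonempty, fun X hX Y hY hne ↦ ?_, fun x hx ↦ ?_⟩
  · have hX := mem_tightParts.1 hX
    have hY := mem_tightParts.1 hY
    by_contra h
    have hu := hX.prop.union hI hY.prop (Set.not_disjoint_iff_nonempty_inter.1 h)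
    exact hne ((hX.eq_of_le hu Set.subset_union_left).trans
      (hY.eq_of_le hu Set.subset_union_right).symm)
  · obtain ⟨Y, hY, h⟩ := (isTight_singleton hI hx).exists_mem_tightParts
    exact ⟨Y, hY, h rfl⟩

/-- A `kl`-sparse set whose edges all lie in a `k`-sparse set `I` or in `k`-tight vertex sets of `I`
has at most `l|I|` members. -/
lemma IsSparse.ncard_le_mul [G.FiniteGraph] (hI : G.IsSparse k I) (hJ : G.IsSparse (l * k) J)
    (hl : 1 ≤ l) (h : ∀ e ∈ J, e ∈ I ∨ ∃ X, G.IsTight k I X ∧ e ∈ G.edgesIn X) :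
    J.ncard ≤ l * I.ncard := by
  have hP := isVertexPartition_tightParts hI
  rw [hP.ncard_eq_sum_add hI.subset, hP.ncard_eq_sum_add hJ.subset, mul_add, Finset.mul_sum]
  gcongr with X hX
  -- Inside a block, l·k(|X|-1) is l times the number of members of I there; crossing members of J
  -- lie in I.
  · have h1 := hJ.le X (hP.subset X hX) (hP.nonempty X hX)
    rw [mul_assoc, ← (mem_tightParts.1 hX).prop.eq, mul_add] at h1
    omega
  · refine le_trans (Set.ncard_le_ncard ?_ (hI.finite.inter_of_left _)) (Nat.le_mul_of_pos_left _ hl)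
    rintro e ⟨heJ, he⟩
    refine ⟨(h e heJ).resolve_right ?_, he⟩
    rintro ⟨X, hX, heX⟩
    obtain ⟨Y, hY, hXY⟩ := hX.exists_mem_tightParts
    exact (hP.mem_crossingEdges_iff (hJ.subset heJ)).1 he Y hY (edgesIn_mono hXY heX)

/-! ### The count matroid and its closure. -/

/-- The matroid on the edge set whose independent sets are the `k`-sparse sets. -/
noncomputable def countMatroid (G : Graph α β) [G.FiniteGraph] (k : ℕ) : Matroid β :=
  (IndepMatroid.ofFinite (E := E(G)) FiniteGraph.edgeSet_finite (G.IsSparse k) isSparse_empty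
    (fun _ _ hJ h ↦ hJ.mono h)
    -- If no edge of J extends I, each one lies in I or in a tight set of I, so the case l = 1 gives
    -- |J| ≤ |I|.
    (fun I J hI hJ h ↦ by
      by_contra! hc
      have := hI.ncard_le_mul (l := 1) (by simpa using hJ) le_rfl fun e he ↦ by
        by_contra! hcon
        exact hc e he hcon.1 ((isSparse_insert_iff hI (hJ.subset he) hcon.1).2 hcon.2)
      omega)
    (fun _ hI ↦ hI.subset)).matroid

@[simp] lemma countMatroid_indep [G.FiniteGraph] : (G.countMatroid k).Indep I ↔ G.IsSparse k I :=
  Iff.rfl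

@[simp] lemma countMatroid_ground [G.FiniteGraph] : (G.countMatroid k).E = E(G) := rfl

instance [G.FiniteGraph] : (G.countMatroid k).Finite :=
  ⟨FiniteGraph.edgeSet_finite (G := G)⟩

lemma IsSparse.mem_closure_iff [G.FiniteGraph] (hI : G.IsSparse k I) (he : e ∈ E(G)) :
    e ∈ (G.countMatroid k).closure I ↔ e ∈ I ∨ ∃ X, G.IsTight k I X ∧ e ∈ G.edgesIn X := by
  by_cases heI : e ∈ I
  · simpa [heI] using (G.countMatroid k).mem_closure_of_mem heI hI.subset
  have h1 := Matroid.Indep.insert_indep_iff_of_notMem (M := G.countMatroid k) hI heI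
  rw [countMatroid_indep, isSparse_insert_iff hI he heI] at h1
  simp only [heI, false_or]
  constructor
  · intro h
    by_contra! hc
    exact (h1.1 hc).2 h
  · rintro ⟨X, hX, heX⟩
    by_contra hc
    exact h1.2 ⟨he, hc⟩ X hX heX

/-- X stays tight for the members of I inside X alone, so these already span everything induced by
X. -/
lemma IsTight.edgesIn_subset_closure [G.FiniteGraph] (hI : G.IsSparse k I)
    (hX : G.IsTight k I X) :
    G.edgesIn X ⊆ (G.countMatroid k).closure (I ∩ G.edgesIn X) := by
  have hs := hI.mono (Set.inter_subset_left (t := G.edgesIn X))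
  intro e he
  rw [hs.mem_closure_iff (edgesIn_subset _ _ he)]
  exact Or.inr ⟨X, ⟨hX.subset, hX.nonempty, by rw [Set.inter_assoc, Set.inter_self, hX.eq]⟩, he⟩

end Graph

/-! ### Matroid partition by exchange chains. -/

namespace Matroid

variable {β : Type*} {M : Matroid β} {m : ℕ} {A : Set β}

/-- The class of colour `i` in a colouring of `A` that leaves the element `s.2` uncoloured. -/
def holeClass (A : Set β) (s : (β → Fin m) × β) (i : Fin m) : Set β :=
  {f | f ∈ A ∧ f ≠ s.2 ∧ s.1 f = i}

open Classical in
/-- An exchange step: the uncoloured element receives a colour, and an element of its fundamental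
circuit in that colour class becomes uncoloured. -/
def HoleStep (M : Matroid β) (A : Set β) (s t : (β → Fin m) × β) : Prop :=
  t.2 ∈ holeClass A s (s.1 t.2) ∧ t.2 ∈ M.fundCircuit s.2 (holeClass A s (s.1 t.2)) ∧
    t.1 = Function.update s.1 s.2 (s.1 t.2)

lemma HoleStep.holeClass_eq {s t : (β → Fin m) × β} (h : M.HoleStep A s t) (hs : s.2 ∈ A) :
    holeClass A t (s.1 t.2) = insert s.2 (holeClass A s (s.1 t.2)) \ {t.2} := by
  classical
  obtain ⟨h1, -, h3⟩ := h
  ext g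
  simp only [holeClass, h3, Set.mem_ofPred_eq, Set.mem_sdiff, Set.mem_insert_iff,
    Set.mem_singleton_iff, Function.update_apply]
  by_cases hg : g = s.2
  · subst hg
    simp [hs]
  · simp only [hg, if_false]
    tauto

lemma HoleStep.holeClass_eq_of_ne {s t : (β → Fin m) × β} (h : M.HoleStep A s t) {i : Fin m}
    (hi : i ≠ s.1 t.2) : holeClass A t i = holeClass A s i := by
  classical
  obtain ⟨h1, -, h3⟩ := h
  ext g
  simp only [holeClass, h3, Set.mem_ofPred_eq, Function.update_apply]
  by_cases hg : g = s.2
  · simp [hg, hi.symm]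
  · simp only [hg, if_false, not_false_eq_true, ne_eq, true_and]
    refine and_congr_right fun _ ↦ ⟨fun h ↦ h.2, fun h ↦ ⟨?_, h⟩⟩
    rintro rfl
    exact hi h.symm

/-- The rest of the circuit lies in B and spans e; after the exchange the rest of the circuit still
spans f. -/
lemma closure_insert_sdiff_eq {e f : β} {B C : Set β} (hC : M.IsCircuit C) (he : e ∈ C)
    (hf : f ∈ C) (hCB : C \ {e} ⊆ B) :
    M.closure (insert e B \ {f}) = M.closure B := by
  have he' : e ∈ M.closure B :=
    M.closure_subset_closure hCB (hC.mem_closure_sdiff_singleton_of_mem he)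
  have hCB' : C ⊆ insert e B := fun g hg ↦ by
    by_cases hge : g = e
    · exact Or.inl hge
    · exact Or.inr (hCB ⟨hg, hge⟩)
  have hf' : f ∈ M.closure (insert e B \ {f}) :=
    M.closure_subset_closure (Set.sdiff_subset_sdiff_left hCB')
      (hC.mem_closure_sdiff_singleton_of_mem hf)
  rw [← closure_insert_eq_of_mem_closure hf', Set.insert_sdiff_singleton,
    Set.insert_eq_of_mem (hCB' hf), closure_insert_eq_of_mem_closure he']

/-- Let R be the set of elements that can become the uncoloured one through exchanges. If no full
colouring exists, every class spans the current hole, and the fundamental circuits involved stay in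
R. Exchanges preserve the closure of each class cut down to R, so every initial class spans R from
within R. The hypothesis then gives |R| ≤ m|class ∩ R| for each of the m classes; summing
contradicts the initial hole being an uncoloured member of R. -/
lemma exists_coloring_of_holeClass_indep (hA : A ⊆ M.E) (hfin : A.Finite)
    (h : ∀ R ⊆ A, ∀ T ⊆ R, M.Indep T → R ⊆ M.closure T → R.ncard ≤ m * T.ncard)
    (s₀ : (β → Fin m) × β) (he₀ : s₀.2 ∈ A) (hs₀ : ∀ i, M.Indep (holeClass A s₀ i)) :
    ∃ c : β → Fin m, ∀ i, M.Indep {e ∈ A | c e = i} := by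
  classical
  by_contra! hcon
  set R : Set β := {e | ∃ c, Relation.ReflTransGen (M.HoleStep A) s₀ (c, e)} with hR
  -- A class that does not span the hole could absorb it, completing the colouring.
  have hcl (s : (β → Fin m) × β) (hs : s.2 ∈ A) (hi : ∀ i, M.Indep (holeClass A s i)) (i) :
      s.2 ∈ M.closure (holeClass A s i) := by
    by_contra hn
    obtain ⟨j, hj⟩ := hcon (Function.update s.1 s.2 i)
    refine hj ?_
    by_cases hji : j = i
    · subst hji
      have : {e ∈ A | Function.update s.1 s.2 j e = j} = insert s.2 (holeClass A s j) := by
        ext g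
        simp only [holeClass, Set.mem_ofPred_eq, Set.mem_insert_iff, Function.update_apply]
        by_cases hg : g = s.2 <;> simp [hg, hs]
      rw [this, insert_indep_iff]
      exact ⟨hi j, fun _ ↦ ⟨hA hs, hn⟩⟩
    · have : {e ∈ A | Function.update s.1 s.2 i e = j} = holeClass A s j := by
        ext g
        simp only [holeClass, Set.mem_ofPred_eq, Function.update_apply]
        by_cases hg : g = s.2
        · simp [hg, Ne.symm hji]
        · simp [hg]
      rw [this]
      exact hi j
  have hnot (s : (β → Fin m) × β) (i) : s.2 ∉ holeClass A s i := fun h ↦ h.2.1 rfl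
  have hcirc (s : (β → Fin m) × β) (hs : s.2 ∈ A) (hi : ∀ i, M.Indep (holeClass A s i)) (i) :
      M.IsCircuit (M.fundCircuit s.2 (holeClass A s i)) :=
    (hi i).fundCircuit_isCircuit (hcl s hs hi i) (hnot s i)
  have hsub (s : (β → Fin m) × β) (hr : Relation.ReflTransGen (M.HoleStep A) s₀ s) (i) :
      M.fundCircuit s.2 (holeClass A s i) \ {s.2} ⊆ holeClass A s i ∩ R := by
    rw [fundCircuit_sdiff_eq_inter _ (hnot s i)]
    rintro g ⟨hg, hg'⟩
    have hgi : s.1 g = i := hg'.2.2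
    refine ⟨hg', Function.update s.1 s.2 i, hr.tail ?_⟩
    subst hgi
    exact ⟨hg', hg, rfl⟩
  have hinv (s) (hr : Relation.ReflTransGen (M.HoleStep A) s₀ s) :
      (s.2 ∈ A ∧ ∀ i, M.Indep (holeClass A s i)) ∧
        ∀ i, M.closure (holeClass A s i ∩ R) = M.closure (holeClass A s₀ i ∩ R) := by
    induction hr with
    | refl => exact ⟨⟨he₀, hs₀⟩, fun _ ↦ rfl⟩
    | @tail s t hr hst ih =>
      obtain ⟨⟨hs, hi⟩, hc⟩ := ih
      refine ⟨⟨hst.1.1, fun i ↦ ?_⟩, fun i ↦ ?_⟩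
      · by_cases hit : i = s.1 t.2
        · rw [hit, hst.holeClass_eq hs, ← (hi _).mem_fundCircuit_iff (hcl s hs hi _) (hnot s _)]
          exact hst.2.1
        · rw [hst.holeClass_eq_of_ne hit]
          exact hi i
      · rw [← hc i]
        by_cases hit : i = s.1 t.2
        · have hsR : s.2 ∈ R := ⟨s.1, hr⟩
          have : holeClass A t i ∩ R = insert s.2 (holeClass A s i ∩ R) \ {t.2} := by
            rw [hit, hst.holeClass_eq hs, ← Set.inter_sdiff_right_comm, Set.insert_inter_of_mem hsR]
          rw [this]
          refine closure_insert_sdiff_eq (hcirc s hs hi i) (M.mem_fundCircuit _ _) ?_ (hsub s hr i)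
          rw [hit]
          exact hst.2.1
        · rw [hst.holeClass_eq_of_ne hit]
  have hRA : R ⊆ A := fun e ⟨c, hc⟩ ↦ (hinv _ hc).1.1
  have hRcl (i) : R ⊆ M.closure (holeClass A s₀ i ∩ R) := by
    rintro e ⟨c, hc⟩
    obtain ⟨⟨hs, hi⟩, hcl'⟩ := hinv _ hc
    rw [← hcl' i]
    exact M.closure_subset_closure (hsub _ hc i)
      ((hcirc _ hs hi i).mem_closure_sdiff_singleton_of_mem (M.mem_fundCircuit _ _))
  have hle (i) : R.ncard ≤ m * (holeClass A s₀ i ∩ R).ncard :=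
    h R hRA _ Set.inter_subset_right ((hs₀ i).subset Set.inter_subset_left) (hRcl i)
  have hm : 0 < m := (s₀.1 s₀.2).pos
  have hsum : ∑ i, (holeClass A s₀ i ∩ R).ncard < R.ncard := by
    rw [← ncard_biUnion_finset]
    · refine Set.ncard_lt_ncard ⟨by simp, fun hss ↦ ?_⟩ (hfin.subset hRA)
      have := hss (show s₀.2 ∈ R from ⟨s₀.1, .refl⟩)
      simp [holeClass] at this
    · exact fun i _ ↦ (hfin.subset hRA).inter_of_right _
    · intro i _ j _ hij
      rw [Function.onFun, Set.disjoint_left]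
      exact fun e he he' ↦ hij (he.1.2.2.symm.trans he'.1.2.2)
  have : ∑ _i : Fin m, R.ncard ≤ ∑ i, m * (holeClass A s₀ i ∩ R).ncard :=
    Finset.sum_le_sum fun i _ ↦ hle i
  rw [← Finset.mul_sum, Finset.sum_const, Finset.card_univ, Fintype.card_fin, smul_eq_mul] at this
  exact absurd (Nat.le_of_mul_le_mul_left this hm) hsum.not_ge

/-- Edmonds' matroid partition theorem. -/
theorem exists_coloring_of_ncard_le (hm : 1 ≤ m) (hA : A ⊆ M.E) (hfin : A.Finite)
    (h : ∀ R ⊆ A, ∀ T ⊆ R, M.Indep T → R ⊆ M.closure T → R.ncard ≤ m * T.ncard) :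
    ∃ c : β → Fin m, ∀ i, M.Indep {e ∈ A | c e = i} := by
  induction A, hfin using Set.Finite.induction_on with
  | empty => exact ⟨fun _ ↦ ⟨0, hm⟩, fun i ↦ by simp⟩
  | @insert e A heA hfin ih =>
    obtain ⟨c, hc⟩ := ih ((Set.subset_insert _ _).trans hA)
      fun R hR ↦ h R (hR.trans (Set.subset_insert _ _))
    -- The colouring of A is a colouring of `insert e A` with hole e.
    refine exists_coloring_of_holeClass_indep hA (hfin.insert e) h (c, e) (by simp) fun i ↦ ?_
    convert hc i using 1
    ext g
    simp only [holeClass, Set.mem_ofPred_eq, Set.mem_insert_iff]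
    by_cases hg : g = e
    · simp [hg, heA]
    · simp [hg]

end Matroid

/-! ### Tree-connectedness through sparse sets. -/

namespace Graph

variable {α β : Type*} {G H T : Graph α β} {k m : ℕ} {I J : Set β} {X Y : Set α} {e : β} {x y v : α}

lemma card_edgeSet_toSimpleGraph (T : Graph α β) [T.Simple] :
    Nat.card T.toSimpleGraph.edgeSet = E(T).ncard := by
  have h (e : E(T)) : ∃ p : Sym2 V(T), p ∈ T.toSimpleGraph.edgeSet ∧
      ∃ x y : V(T), p = s(x, y) ∧ T.IsLink e x y := by
    obtain ⟨x, y, hl⟩ := exists_isLink_of_mem_edgeSet e.2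
    refine ⟨s(⟨x, hl.left_mem⟩, ⟨y, hl.right_mem⟩), ?_, _, _, rfl, hl⟩
    rw [SimpleGraph.mem_edgeSet, toSimpleGraph_adj_iff]
    exact hl.adj
  choose f hf hf' using h
  rw [← Nat.card_coe_set_eq]
  refine (Nat.card_congr (Equiv.ofBijective (fun e ↦ ⟨f e, hf e⟩) ⟨?_, ?_⟩)).symm
  · intro e e' hee
    obtain ⟨x, y, h1, h2⟩ := hf' e
    obtain ⟨x', y', h1', h2'⟩ := hf' e'
    have hff : s(x, y) = s(x', y') := by rw [← h1, ← h1']; exact congrArg Subtype.val hee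
    rw [Sym2.eq_iff] at hff
    obtain ⟨rfl, rfl⟩ | ⟨rfl, rfl⟩ := hff
    · exact Subtype.ext (h2.eq h2')
    · exact Subtype.ext (h2.eq h2'.symm)
  · rintro ⟨p, hp⟩
    induction p with | _ x y
    rw [SimpleGraph.mem_edgeSet, toSimpleGraph_adj_iff] at hp
    obtain ⟨e, he⟩ := hp
    refine ⟨⟨e, he.edge_mem⟩, Subtype.ext ?_⟩
    obtain ⟨x', y', h1', h2'⟩ := hf' ⟨e, he.edge_mem⟩
    change f _ = s(x, y)
    rw [h1', Sym2.eq_iff]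
    simpa [Subtype.ext_iff] using h2'.eq_and_eq_or_eq_and_eq he

/-- A forest extends to a spanning tree of the complete graph. -/
lemma _root_.SimpleGraph.IsAcyclic.card_edgeSet_add_one_le {V : Type*} [Finite V] [Nonempty V]
    {G : SimpleGraph V} (h : G.IsAcyclic) : Nat.card G.edgeSet + 1 ≤ Nat.card V := by
  obtain ⟨F, hGF, hF⟩ := SimpleGraph.exists_maximal_isAcyclic_of_le_isAcyclic
    (le_top : G ≤ ⊤) h
  have hT : F.IsTree := (SimpleGraph.connected_top.maximal_le_isAcyclic_iff_isTree le_top).1 hF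
  rw [← (SimpleGraph.isTree_iff_connected_and_card.1 hT).2, Nat.card_coe_set_eq,
    Nat.card_coe_set_eq]
  gcongr
  · exact Set.toFinite _

lemma IsTreeGraph.isSparse [T.FiniteGraph] (hT : T.IsTreeGraph) : T.IsSparse 1 E(T) := by
  obtain ⟨hs, ht⟩ := hT
  refine ⟨subset_rfl, fun X hX hne ↦ ?_⟩
  have : (T.induce X).Simple := Simple.anti (induce_le hX)
  have : Finite V(T.induce X) := finite_of_subset_vertexSet hX
  have : Nonempty V(T.induce X) := hne.to_subtype
  let f : (T.induce X).toSimpleGraph →g T.toSimpleGraph :=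
    ⟨fun x ↦ ⟨x.1, hX x.2⟩, fun {a b} hab ↦ by
      rw [toSimpleGraph_adj_iff] at hab ⊢
      exact hab.mono (induce_le hX)⟩
  have hac : (T.induce X).toSimpleGraph.IsAcyclic :=
    ht.isAcyclic.comap f fun a b hab ↦ Subtype.ext (congrArg (fun z ↦ z.1) hab)
  have := hac.card_edgeSet_add_one_le
  rw [card_edgeSet_toSimpleGraph, Nat.card_coe_set_eq] at this
  rw [Set.inter_eq_self_of_subset_right (edgesIn_subset _ _), one_mul]
  exact this

lemma IsTreeGraph.ncard_edgeSet_add_one [T.FiniteGraph] (hT : T.IsTreeGraph) :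
    E(T).ncard + 1 = V(T).ncard := by
  obtain ⟨hs, ht⟩ := hT
  have : Finite V(T) := FiniteGraph.vertexSet_finite (G := T)
  have := (SimpleGraph.isTree_iff_connected_and_card.1 ht).2
  rwa [card_edgeSet_toSimpleGraph, Nat.card_coe_set_eq] at this

/-- Sparsity on one vertex excludes loops and on two vertices parallel edges. If the graph were
disconnected, the bounds for a component and its complement would leave at most |V| - 2 edges. -/
lemma isTreeGraph_restrict [G.FiniteGraph] (hI : G.IsSparse 1 I) (h : I.ncard + 1 = V(G).ncard) :
    (G.restrict I).IsTreeGraph := by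
  have hsimple : (G.restrict I).Simple := by
    refine { not_isLoopAt := fun e x hl ↦ ?_, eq_of_isLink := fun e f x y he hf ↦ ?_ }
    · obtain ⟨heI, hl⟩ : e ∈ I ∧ G.IsLink e x x := hl
      have := hI.le {x} (by simpa using hl.left_mem) (by simp)
      have h0 : 0 < (I ∩ G.edgesIn {x}).ncard :=
        (Set.ncard_pos (hI.finite.inter_of_left _)).2 ⟨e, heI, x, x, hl, rfl, rfl⟩
      simp at this
      omega
    · by_contra hne
      have hx := he.2.left_mem
      have hy := he.2.right_mem
      have h1 := hI.le {x, y} (Set.insert_subset hx (by simpa)) (by simp)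
      have h2 : ({e, f} : Set β).ncard ≤ (I ∩ G.edgesIn {x, y}).ncard := by
        refine Set.ncard_le_ncard ?_ (hI.finite.inter_of_left _)
        rintro g (rfl | rfl)
        · exact ⟨he.1, x, y, he.2, by simp, by simp⟩
        · exact ⟨hf.1, x, y, hf.2, by simp, by simp⟩
      rw [Set.ncard_pair hne] at h2
      have := Set.ncard_insert_le x {y}
      rw [Set.ncard_singleton] at this
      omega
  refine ⟨hsimple, ?_⟩
  have hfin : Finite V(G.restrict I) := FiniteGraph.vertexSet_finite (G := G)
  have hE : E(G.restrict I) = I := Set.inter_eq_self_of_subset_right hI.subset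
  rw [SimpleGraph.isTree_iff_connected_and_card, card_edgeSet_toSimpleGraph, Nat.card_coe_set_eq,
    hE]
  refine ⟨?_, h⟩
  have hne : V(G).Nonempty := Set.nonempty_of_ncard_ne_zero (by omega)
  have : Nonempty V(G.restrict I) := hne.to_subtype
  rw [SimpleGraph.connected_iff]
  refine ⟨fun a b ↦ ?_, this⟩
  by_contra hab
  set X : Set α := {x | ∃ hx : x ∈ V(G), (G.restrict I).toSimpleGraph.Reachable a ⟨x, hx⟩} with hX
  have hXV : X ⊆ V(G) := fun x hx ↦ hx.1
  have haX : a.1 ∈ X := ⟨a.2, .refl _⟩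
  have hbX : b.1 ∈ V(G) \ X := ⟨b.2, fun hb ↦ hab hb.2⟩
  have hsub : I ⊆ (I ∩ G.edgesIn X) ∪ (I ∩ G.edgesIn (V(G) \ X)) := by
    intro e he
    obtain ⟨x, y, hl⟩ := exists_isLink_of_mem_edgeSet (hI.subset he)
    have hadj : (G.restrict I).toSimpleGraph.Adj ⟨x, hl.left_mem⟩ ⟨y, hl.right_mem⟩ := by
      rw [toSimpleGraph_adj_iff]
      exact ⟨e, he, hl⟩
    by_cases hx : x ∈ X
    · exact Or.inl ⟨he, x, y, hl, hx, hl.right_mem, hx.2.trans hadj.reachable⟩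
    · refine Or.inr ⟨he, x, y, hl, ⟨hl.left_mem, hx⟩, hl.right_mem, fun hy ↦ hx ⟨hl.left_mem, ?_⟩⟩
      exact hy.2.trans hadj.symm.reachable
  have h1 := (Set.ncard_le_ncard hsub ((hI.finite.inter_of_left _).union
    (hI.finite.inter_of_left _))).trans (Set.ncard_union_le _ _)
  have h2 := hI.le X hXV ⟨_, haX⟩
  have h3 := hI.le (V(G) \ X) Set.sdiff_subset ⟨_, hbX⟩
  have h4 := Set.ncard_sdiff_add_ncard_of_subset hXV FiniteGraph.vertexSet_finite
  omega

/-- Nash-Williams: an `m`-sparse edge set splits into `m` forests. -/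
lemma IsSparse.exists_coloring [G.FiniteGraph] (hm : 1 ≤ m) (hJ : G.IsSparse m J) :
    ∃ c : β → Fin m, ∀ i, G.IsSparse 1 {e ∈ J | c e = i} := by
  refine (G.countMatroid 1).exists_coloring_of_ncard_le hm hJ.subset hJ.finite ?_
  intro R hR T hTR hT hcl
  refine IsSparse.ncard_le_mul (k := 1) hT (by simpa using hJ.mono hR) hm fun e he ↦ ?_
  rw [← IsSparse.mem_closure_iff hT (hJ.subset (hR he))]
  exact hcl he

/-- `m`-tree-connectedness in terms of sparse edge sets. -/
theorem isTreeConnected_iff [G.FiniteGraph] (hm : 1 ≤ m) :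
    G.IsTreeConnected m ↔
      V(G).Nonempty ∧ ∃ J, G.IsSparse m J ∧ J.ncard + m = m * V(G).ncard := by
  constructor
  · rintro ⟨T, hT, hd⟩
    have hfg (i) : (T i).FiniteGraph := .of_le (hT i).1.le
    have hV (i) : V(T i) = V(G) := (hT i).1.vertexSet_eq
    have hfinE (i) : E(T i).Finite := FiniteGraph.edgeSet_finite
    have hcount (f : Fin m → Set β) (hf : ∀ i, f i ⊆ E(T i)) :
        (⋃ i, f i).ncard = ∑ i, (f i).ncard := by
      rw [← ncard_biUnion_finset]
      · simp
      · exact fun i _ ↦ (hfinE i).subset (hf i)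
      · exact fun i _ j _ hij ↦ (hd hij).mono (hf i) (hf j)
    refine ⟨?_, ⋃ i, E(T i), ⟨?_, fun X hX hne ↦ ?_⟩, ?_⟩
    · rw [← hV ⟨0, hm⟩]
      have := (hT ⟨0, hm⟩).2.ncard_edgeSet_add_one
      exact Set.nonempty_of_ncard_ne_zero (by omega)
    · exact Set.iUnion_subset fun i ↦ (hT i).1.le.edgeSet_mono
    · rw [Set.iUnion_inter, hcount _ fun i ↦ Set.inter_subset_left]
      have hle (i) : (E(T i) ∩ G.edgesIn X).ncard + 1 ≤ X.ncard := by
        have := (hT i).2.isSparse.le X (by rwa [hV]) hne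
        rwa [edgesIn_of_le (hT i).1.le, Set.inter_comm (G.edgesIn X), ← Set.inter_assoc,
          Set.inter_self, one_mul] at this
      have := Finset.sum_le_sum fun i (_ : i ∈ Finset.univ) ↦ hle i
      simpa [Finset.sum_add_distrib] using this
    · rw [hcount _ fun i ↦ subset_rfl]
      have := Finset.sum_congr rfl fun i (_ : i ∈ Finset.univ) ↦ (hT i).2.ncard_edgeSet_add_one
      simpa [Finset.sum_add_distrib, hV] using this
  · rintro ⟨hne, J, hJ, hcard⟩
    obtain ⟨c, hc⟩ := hJ.exists_coloring hm
    have hle (i) : {e ∈ J | c e = i}.ncard + 1 ≤ V(G).ncard := by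
      simpa using (hc i).ncard_add_le hne
    have hsum : ∑ i, ({e ∈ J | c e = i}.ncard + 1) = ∑ _i : Fin m, V(G).ncard := by
      rw [Finset.sum_add_distrib, ← ncard_biUnion_finset]
      · simp only [Finset.mem_univ, Set.iUnion_true, Finset.sum_const, Finset.card_univ,
          Fintype.card_fin, smul_eq_mul, mul_one]
        rw [← hcard]
        congr 2
        ext e
        simp
      · exact fun i _ ↦ (hc i).finite
      · intro i _ j _ hij
        rw [Function.onFun, Set.disjoint_left]
        exact fun e he he' ↦ hij (he.2.symm.trans he'.2)
    -- Each of the m forests has at most |V| - 1 edges, and the total m(|V| - 1) forces equality in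
    -- all of them.
    have heq := (Finset.sum_eq_sum_iff_of_le fun i _ ↦ hle i).1 hsum
    refine ⟨fun i ↦ G.restrict {e ∈ J | c e = i}, fun i ↦ ⟨⟨restrict_le, rfl⟩,
      isTreeGraph_restrict (hc i) (heq i (Finset.mem_univ _))⟩, fun i j hij ↦ ?_⟩
    refine Set.disjoint_left.2 ?_
    exact fun e he he' ↦ hij (he.2.2.symm.trans he'.2.2)

end Graph

/-! ### Components as maximal tight sets, and `Omega` as a corank. -/

namespace Graph

variable {α β : Type*} {G H T : Graph α β} {k m : ℕ} {I J : Set β} {X Y : Set α} {e : β} {x y v : α}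

/-- Vertices outside H meet no member of J, so sets sticking out of V(H) impose only weaker bounds.
-/
lemma isSparse_iff_of_le [G.FiniteGraph] (h : H ≤ G) :
    H.IsSparse k J ↔ G.IsSparse k J ∧ J ⊆ E(H) := by
  have hHfin : H.FiniteGraph := .of_le h
  have hi (hJ : J ⊆ E(H)) (X) : J ∩ H.edgesIn X = J ∩ G.edgesIn X := by
    rw [edgesIn_of_le h, Set.inter_comm (G.edgesIn X), ← Set.inter_assoc,
      Set.inter_eq_self_of_subset_left hJ]
  constructor
  · refine fun hJ ↦ ⟨⟨hJ.subset.trans h.edgeSet_mono, fun X hX hne ↦ ?_⟩, hJ.subset⟩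
    have heq : J ∩ G.edgesIn X = J ∩ H.edgesIn (X ∩ V(H)) := by
      rw [edgesIn_inter, edgesIn_vertexSet, ← Set.inter_assoc, hi hJ.subset, Set.inter_assoc,
        Set.inter_comm (G.edgesIn X), ← Set.inter_assoc, Set.inter_eq_self_of_subset_left hJ.subset]
    rw [heq]
    have hle : (X ∩ V(H)).ncard ≤ X.ncard :=
      Set.ncard_le_ncard Set.inter_subset_left (finite_of_subset_vertexSet hX)
    by_cases hXH : (X ∩ V(H)).Nonempty
    · exact (hJ.le _ Set.inter_subset_right hXH).trans (Nat.mul_le_mul_left _ hle)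
    · rw [Set.not_nonempty_iff_eq_empty] at hXH
      have hpos := (Set.ncard_pos (finite_of_subset_vertexSet hX)).2 hne
      simpa [hXH, edgesIn] using Nat.le_mul_of_pos_right k hpos
  · rintro ⟨hJ, hJH⟩
    refine ⟨hJH, fun X hX hne ↦ ?_⟩
    rw [hi hJH]
    exact hJ.le X (hX.trans h.vertexSet_mono) hne

lemma isTight_iff_of_le (h : H ≤ G) (hJ : J ⊆ E(H)) (hX : X ⊆ V(H)) :
    H.IsTight k J X ↔ G.IsTight k J X := by
  have hi : J ∩ H.edgesIn X = J ∩ G.edgesIn X := by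
    rw [edgesIn_of_le h, Set.inter_comm (G.edgesIn X), ← Set.inter_assoc,
      Set.inter_eq_self_of_subset_left hJ]
  constructor
  · exact fun h' ↦ ⟨hX.trans h.vertexSet_mono, h'.nonempty, hi ▸ h'.eq⟩
  · exact fun h' ↦ ⟨hX, h'.nonempty, hi ▸ h'.eq⟩

lemma isTreeConnected_induce_iff [G.FiniteGraph] (hm : 1 ≤ m) (hX : X ⊆ V(G)) :
    (G.induce X).IsTreeConnected m ↔ ∃ J, G.IsSparse m J ∧ G.IsTight m J X := by
  have : (G.induce X).FiniteGraph := .of_le (induce_le hX)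
  rw [isTreeConnected_iff hm]
  constructor
  · rintro ⟨hne, J, hJ, hcard⟩
    rw [isSparse_iff_of_le (induce_le hX)] at hJ
    refine ⟨J, hJ.1, hX, hne, ?_⟩
    rwa [show J ∩ G.edgesIn X = J from Set.inter_eq_self_of_subset_left hJ.2]
  · rintro ⟨J, hJ, hJX⟩
    refine ⟨hJX.nonempty, J ∩ G.edgesIn X, ?_, hJX.eq⟩
    rw [isSparse_iff_of_le (induce_le hX)]
    exact ⟨hJ.mono Set.inter_subset_left, Set.inter_subset_right⟩

/-- Let U be the union of the maximal I-tight sets Y meeting X, q in number. Tightness of X for J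
and sparsity of J on each Y ∩ X leave at least k(q-1) edges of J in X between different Y. Being
spanned by I but inside no tight set of I, these belong to I, and with the k(|Y|-1) edges of I in
each Y they make U tight. -/
lemma IsTight.exists_isTight_superset [G.FiniteGraph] (hI : G.IsSparse k I) (hJ : G.IsSparse k J)
    (hJI : J ⊆ (G.countMatroid k).closure I) (hX : G.IsTight k J X) :
    ∃ Y, G.IsTight k I Y ∧ X ⊆ Y := by
  classical
  have hP := isVertexPartition_tightParts hI
  set P := G.tightParts k I with hPdef
  set Q := P.filter fun Y ↦ (Y ∩ X).Nonempty with hQ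
  have hQP : ∀ Y ∈ Q, Y ∈ P := fun Y hY ↦ (Finset.mem_filter.1 hY).1
  set U : Set α := ⋃ Y ∈ Q, Y with hU
  have hXU : X ⊆ U := fun x hx ↦ by
    obtain ⟨Y, hY, hxY⟩ := hP.cover x (hX.subset hx)
    exact Set.mem_biUnion (Finset.mem_filter.2 ⟨hY, x, hxY, hx⟩) hxY
  have hUV : U ⊆ V(G) := Set.iUnion₂_subset fun Y hY ↦ hP.subset Y (hQP Y hY)
  refine ⟨U, ⟨hUV, hX.nonempty.mono hXU, (hI.le U hUV (hX.nonempty.mono hXU)).antisymm ?_⟩, hXU⟩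
  have hUcard : U.ncard = ∑ Y ∈ Q, Y.ncard :=
    ncard_biUnion_finset Q (fun Y ↦ Y) (fun Y hY ↦ finite_of_subset_vertexSet (hP.subset Y (hQP Y hY)))
      fun Y hY Z hZ hne ↦ hP.disjoint (hQP Y hY) (hQP Z hZ) hne
  have hXcard : X.ncard = ∑ Y ∈ Q, (Y ∩ X).ncard := by
    rw [← hP.sum_ncard_inter hX.subset, Finset.sum_filter_of_ne]
    exact fun Y hY h ↦ Set.nonempty_of_ncard_ne_zero h
  set K := J ∩ G.edgesIn X with hK
  have hKcard := hP.ncard_eq_sum_add (J := K) (Set.inter_subset_left.trans hJ.subset)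
  have hKeq (Y) : K ∩ G.edgesIn Y = J ∩ G.edgesIn (Y ∩ X) := by
    rw [edgesIn_inter, hK, Set.inter_assoc, Set.inter_comm (G.edgesIn X)]
  have hKQ : ∑ Y ∈ P, (K ∩ G.edgesIn Y).ncard = ∑ Y ∈ Q, (K ∩ G.edgesIn Y).ncard := by
    rw [Finset.sum_filter_of_ne]
    intro Y hY h
    rw [hKeq] at h
    obtain ⟨e, -, x, y, -, hx, -⟩ := Set.nonempty_of_ncard_ne_zero h
    exact ⟨x, hx⟩
  have hKle : ∑ Y ∈ Q, ((K ∩ G.edgesIn Y).ncard + k) ≤ ∑ Y ∈ Q, k * (Y ∩ X).ncard := by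
    refine Finset.sum_le_sum fun Y hY ↦ ?_
    rw [hKeq]
    exact hJ.le _ (Set.inter_subset_left.trans (hP.subset Y (hQP Y hY))) (Finset.mem_filter.1 hY).2
  have hIeq : ∑ Y ∈ Q, ((I ∩ G.edgesIn Y).ncard + k) = ∑ Y ∈ Q, k * Y.ncard :=
    Finset.sum_congr rfl fun Y hY ↦ (mem_tightParts.1 (hQP Y hY)).prop.eq
  have hcross : K ∩ G.crossingEdges P ⊆ I ∩ G.edgesIn X := by
    rintro e ⟨⟨heJ, heX⟩, he⟩
    refine ⟨((hI.mem_closure_iff (hJ.subset heJ)).1 (hJI heJ)).resolve_right ?_, heX⟩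
    rintro ⟨Z, hZ, heZ⟩
    obtain ⟨Y, hY, hZY⟩ := hZ.exists_mem_tightParts
    exact (hP.mem_crossingEdges_iff (hJ.subset heJ)).1 he Y hY (edgesIn_mono hZY heZ)
  have hIU : ∑ Y ∈ Q, (I ∩ G.edgesIn Y).ncard + (K ∩ G.crossingEdges P).ncard
      ≤ (I ∩ G.edgesIn U).ncard := by
    rw [← ncard_biUnion_finset Q _ (fun Y _ ↦ hI.finite.inter_of_left _), ← Set.ncard_union_eq ?_
      (hI.finite.subset (by simp)) (hI.finite.subset (hcross.trans Set.inter_subset_left))]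
    · refine Set.ncard_le_ncard (Set.union_subset (Set.iUnion₂_subset fun Y hY ↦ ?_) ?_)
        (hI.finite.inter_of_left _)
      · exact Set.inter_subset_inter_right _ (edgesIn_mono (Set.subset_iUnion₂ (s := fun Y _ ↦ Y) Y hY))
      · exact hcross.trans (Set.inter_subset_inter_right _ (edgesIn_mono hXU))
    · rw [Set.disjoint_left]
      intro e he he'
      obtain ⟨Y, hY, -, heY⟩ := Set.mem_iUnion₂.1 he
      exact (hP.mem_crossingEdges_iff (hJ.subset he'.1.1)).1 he'.2 Y (hQP Y hY) heY
    · exact fun Y hY Z hZ hne ↦ (edgesIn_disjoint (hP.disjoint (hQP Y hY) (hQP Z hZ) hne)).mono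
        Set.inter_subset_right Set.inter_subset_right
  have hXeq := hX.eq
  rw [Finset.sum_add_distrib, ← Finset.mul_sum] at hKle hIeq
  rw [← hXcard] at hKle
  rw [← hUcard] at hIeq
  rw [hKQ] at hKcard
  linarith

/-- A vertex set inducing an m-tree-connected subgraph is tight for some sparse J, which I spans, so
it lies in an I-tight set; the maximal sets therefore agree. -/
lemma treeComponents_eq [G.FiniteGraph] (hm : 1 ≤ m) (hI : G.IsSparse m I)
    (hcl : E(G) ⊆ (G.countMatroid m).closure I) :
    G.treeComponents m = G.tightParts m I := by
  have hiff (X : Set α) : (X ⊆ V(G) ∧ (G.induce X).IsTreeConnected m) ↔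
      X ⊆ V(G) ∧ ∃ J, G.IsSparse m J ∧ G.IsTight m J X :=
    and_congr_right fun hX ↦ isTreeConnected_induce_iff hm hX
  ext X
  rw [SetLike.mem_coe, mem_tightParts, treeComponents, Set.mem_ofPred_eq]
  simp only [hiff]
  constructor
  · intro h
    obtain ⟨hX, J, hJ, hJX⟩ := h.prop
    obtain ⟨Y, hY, hXY⟩ := hJX.exists_isTight_superset hI hJ (hJ.subset.trans hcl)
    obtain rfl := h.eq_of_le ⟨hY.subset, I, hI, hY⟩ hXY
    exact ⟨hY, fun Z hZ hle ↦ h.le_of_ge ⟨hZ.subset, I, hI, hZ⟩ hle⟩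
  · refine fun h ↦ ⟨⟨h.prop.subset, I, hI, h.prop⟩, ?_⟩
    rintro Z ⟨hZ, J, hJ, hJZ⟩ hle
    obtain ⟨Y, hY, hZY⟩ := hJZ.exists_isTight_superset hI hJ (hJ.subset.trans hcl)
    exact hZY.trans (h.le_of_ge hY (hle.trans hZY))

lemma crossingEdges_tightParts_subset [G.FiniteGraph] (hI : G.IsSparse m I) :
    (G.countMatroid m).closure I ∩ G.crossingEdges (G.tightParts m I) ⊆ I := by
  rintro e ⟨he, hcr⟩
  have heE : e ∈ E(G) := (G.countMatroid m).closure_subset_ground _ he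
  refine ((hI.mem_closure_iff heE).1 he).resolve_right ?_
  rintro ⟨Z, hZ, heZ⟩
  obtain ⟨Y, hY, hZY⟩ := hZ.exists_mem_tightParts
  exact ((isVertexPartition_tightParts hI).mem_crossingEdges_iff heE).1 hcr Y hY
    (edgesIn_mono hZY heZ)

lemma crossingEdges_subset (G : Graph α β) (P : Set (Set α)) : G.crossingEdges P ⊆ E(G) := by
  rintro e ⟨x, y, h, -⟩
  exact h.edge_mem

lemma IsSparse.ncard_add_mul_card_tightParts [G.FiniteGraph] (hI : G.IsSparse m I) :
    I.ncard + m * (G.tightParts m I).card =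
      m * V(G).ncard + (I ∩ G.crossingEdges (G.tightParts m I)).ncard := by
  have hP := isVertexPartition_tightParts hI
  have h1 := hP.ncard_eq_sum_add hI.subset
  have h2 : ∑ X ∈ G.tightParts m I, ((I ∩ G.edgesIn X).ncard + m) =
      ∑ X ∈ G.tightParts m I, m * X.ncard :=
    Finset.sum_congr rfl fun X hX ↦ (mem_tightParts.1 hX).prop.eq
  rw [← Finset.mul_sum, hP.sum_ncard, Finset.sum_add_distrib, Finset.sum_const, smul_eq_mul] at h2
  linarith

lemma omega_eq [G.FiniteGraph] (hm : 1 ≤ m) (hI : G.IsSparse m I)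
    (hcl : E(G) ⊆ (G.countMatroid m).closure I) :
    G.Omega m = (m : ℤ) * V(G).ncard - I.ncard := by
  have hc : I ∩ G.crossingEdges (G.tightParts m I) = G.crossingEdges (G.tightParts m I) :=
    Set.inter_eq_self_of_subset_right fun e he ↦ crossingEdges_tightParts_subset hI
      ⟨hcl (crossingEdges_subset _ _ he), he⟩
  have h := hI.ncard_add_mul_card_tightParts
  rw [Omega, treeComponents_eq hm hI hcl, Set.ncard_coe_finset]
  rw [hc] at h
  zify at h
  linarith

/-- Summed sparsity over the blocks; for maximal tight blocks the same sum is an equality. -/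
lemma IsSparse.ncard_add_mul_card_le [G.FiniteGraph] (hI : G.IsSparse m I)
    {P : Finset (Set α)} (hP : G.IsVertexPartition P) :
    I.ncard + m * P.card ≤ m * V(G).ncard + (I ∩ G.crossingEdges P).ncard := by
  have h1 := hP.ncard_eq_sum_add hI.subset
  have h2 : ∑ X ∈ P, ((I ∩ G.edgesIn X).ncard + m) ≤ ∑ X ∈ P, m * X.ncard :=
    Finset.sum_le_sum fun X hX ↦ hI.le X (hP.subset X hX) (hP.nonempty X hX)
  rw [← Finset.mul_sum, hP.sum_ncard, Finset.sum_add_distrib, Finset.sum_const, smul_eq_mul] at h2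
  linarith

lemma exists_isSparse_spanning (G : Graph α β) [G.FiniteGraph] (m : ℕ) {A : Set β}
    (hA : A ⊆ E(G)) :
    ∃ I, G.IsSparse m I ∧ I ⊆ A ∧ A ⊆ (G.countMatroid m).closure I := by
  obtain ⟨I, hI⟩ := (G.countMatroid m).exists_isBasis A hA
  exact ⟨I, hI.indep, hI.subset, hI.subset_closure⟩

/-- `Ω_m(G) = m|V(G)| - r(G)`, where `r(G)` is the largest size of an `m`-sparse edge set. -/
lemma exists_isSparse_omega_eq [G.FiniteGraph] (hm : 1 ≤ m) :
    ∃ I, G.IsSparse m I ∧ G.Omega m = (m : ℤ) * V(G).ncard - I.ncard := by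
  obtain ⟨I, hI, -, hcl⟩ := G.exists_isSparse_spanning m subset_rfl
  exact ⟨I, hI, omega_eq hm hI hcl⟩

lemma IsSparse.omega_le [G.FiniteGraph] (hm : 1 ≤ m) (hJ : G.IsSparse m J) :
    G.Omega m ≤ (m : ℤ) * V(G).ncard - J.ncard := by
  obtain ⟨I, hI, -, hcl⟩ := G.exists_isSparse_spanning m subset_rfl
  rw [omega_eq hm hI hcl]
  have := hI.ncard_le_mul (l := 1) (by simpa using hJ) le_rfl fun e he ↦
    (hI.mem_closure_iff (hJ.subset he)).1 (hcl (hJ.subset he))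
  omega

end Graph

/-! ### Exchanges and the saturated set. -/

namespace Graph

variable {α β : Type*} {G : Graph α β} {m : ℕ} {F₀ I I' J : Set β} {S S' X Y : Set α}
  {h : α → ℕ} {e f : β} {x y v : α}

/-- The set of labels that are incident in `G` with no vertex of `S`. -/
def avoiding (G : Graph α β) (S : Set α) : Set β := {e | ∀ v ∈ S, ¬ G.Inc e v}

lemma avoiding_anti (h : S ⊆ S') : G.avoiding S' ⊆ G.avoiding S := fun _ he v hv ↦ he v (h hv)

/-- The members of `I` that avoid `S`, together with `F₀`. -/
def coreEdges (G : Graph α β) (F₀ I : Set β) (S : Set α) : Set β := F₀ ∪ (I ∩ G.avoiding S)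

lemma coreEdges_anti (h : S ⊆ S') : G.coreEdges F₀ I S' ⊆ G.coreEdges F₀ I S :=
  Set.union_subset_union_right _ (Set.inter_subset_inter_right _ (avoiding_anti h))

lemma coreEdges_subset (h : F₀ ⊆ I) : G.coreEdges F₀ I S ⊆ I :=
  Set.union_subset h Set.inter_subset_left

lemma coreEdges_subset_union : G.coreEdges F₀ I S ⊆ F₀ ∪ G.avoiding S :=
  Set.union_subset_union_right _ Set.inter_subset_right

lemma Inc.mem_of_mem_edgesIn (hi : G.Inc e v) (he : e ∈ G.edgesIn X) : v ∈ X := by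
  obtain ⟨w, hl⟩ := hi
  exact (hl.mem_edgesIn_iff.1 he).1

/-- The `m`-sparse sets containing `F₀` whose members outside `F₀` obey the degree bound `h`. -/
structure IsAdmissible (G : Graph α β) (m : ℕ) (F₀ : Set β) (h : α → ℕ) (I : Set β) : Prop where
  sparse : G.IsSparse m I
  subset : F₀ ⊆ I
  degree_le : ∀ v, ((I \ F₀) ∩ G.incidenceSet v).ncard ≤ h v

/-- A vertex is free with respect to `S` when an exchange inside a tight set of the core yields an
admissible set in which the degree bound at the vertex is strict. -/
def IsFree (G : Graph α β) (m : ℕ) (F₀ : Set β) (h : α → ℕ) (I : Set β) (S : Set α) (v : α) :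
    Prop :=
  ∃ X I', G.IsTight m (G.coreEdges F₀ I S) X ∧ v ∈ X ∧ G.IsAdmissible m F₀ h I' ∧
    I' \ G.edgesIn X = I \ G.edgesIn X ∧ G.IsTight m I' X ∧
    I' ∩ G.edgesIn X ⊆ F₀ ∪ G.avoiding S ∧ ((I' \ F₀) ∩ G.incidenceSet v).ncard < h v

lemma IsTight.of_sdiff_eq (hX : G.IsTight m I X) (hI : I.Finite) (hI' : I'.Finite)
    (hcard : I'.ncard = I.ncard) (h : I' \ G.edgesIn X = I \ G.edgesIn X) : G.IsTight m I' X := by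
  refine ⟨hX.subset, hX.nonempty, ?_⟩
  have h1 := Set.ncard_inter_add_ncard_sdiff_eq_ncard I (G.edgesIn X) hI
  have h2 := Set.ncard_inter_add_ncard_sdiff_eq_ncard I' (G.edgesIn X) hI'
  have := hX.eq
  rw [h] at h2
  omega

lemma IsTight.ncard_eq_of_sdiff_eq (hX : G.IsTight m I X) (hX' : G.IsTight m I' X) (hI : I.Finite)
    (hI' : I'.Finite) (h : I' \ G.edgesIn X = I \ G.edgesIn X) : I'.ncard = I.ncard := by
  have h1 := Set.ncard_inter_add_ncard_sdiff_eq_ncard I (G.edgesIn X) hI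
  have h2 := Set.ncard_inter_add_ncard_sdiff_eq_ncard I' (G.edgesIn X) hI'
  have := hX.eq
  have := hX'.eq
  rw [h] at h2
  omega

/-- A basis of J spans I, hence has at least |I| ≥ |J| elements and is all of J. -/
lemma IsSparse.isSparse_of_subset_closure [G.FiniteGraph] (hI : G.IsSparse m I) (hJ : J ⊆ E(G))
    (hcl : I ⊆ (G.countMatroid m).closure J) (hcard : J.ncard ≤ I.ncard) :
    G.IsSparse m J ∧ J.ncard = I.ncard := by
  obtain ⟨B, hB⟩ := (G.countMatroid m).exists_isBasis J hJ
  have hBs : G.IsSparse m B := hB.indep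
  rw [← hB.closure_eq_closure] at hcl
  have h1 := hBs.ncard_le_mul (l := 1) (by simpa using hI) le_rfl fun e he ↦
    (hBs.mem_closure_iff (hI.subset he)).1 (hcl he)
  have hJfin := finite_of_subset_edgeSet hJ
  have h2 := Set.ncard_le_ncard hB.subset hJfin
  have hBJ : B = J := Set.eq_of_subset_of_ncard_le hB.subset (by omega) hJfin
  subst hBJ
  exact ⟨hBs, by omega⟩

/-- The tight sets witnessing freeness of x and y are disjoint, since otherwise their union would be
tight and contain both. The two exchanges therefore involve disjoint edge sets and can be made
together. As both sets are tight for the core, the new core stays in the closure of the old one. -/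
lemma IsAdmissible.exists_exchange [G.FiniteGraph] (hI : G.IsAdmissible m F₀ h I)
    (hx : G.IsFree m F₀ h I S x) (hy : G.IsFree m F₀ h I S y)
    (hxy : ∀ X, G.IsTight m (G.coreEdges F₀ I S) X → x ∈ X → y ∉ X) :
    ∃ X₁ X₂ I'', G.IsTight m (G.coreEdges F₀ I S) X₁ ∧ G.IsTight m (G.coreEdges F₀ I S) X₂ ∧
      x ∈ X₁ ∧ y ∈ X₂ ∧ G.IsAdmissible m F₀ h I'' ∧ I''.ncard = I.ncard ∧
      I'' \ (G.edgesIn X₁ ∪ G.edgesIn X₂) = I \ (G.edgesIn X₁ ∪ G.edgesIn X₂) ∧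
      I'' ∩ (G.edgesIn X₁ ∪ G.edgesIn X₂) ⊆ F₀ ∪ G.avoiding S ∧
      ((I'' \ F₀) ∩ G.incidenceSet x).ncard < h x ∧
      ((I'' \ F₀) ∩ G.incidenceSet y).ncard < h y ∧
      G.coreEdges F₀ I'' S ⊆ (G.countMatroid m).closure (G.coreEdges F₀ I S) := by
  obtain ⟨X₁, I₁, hX₁, hx₁, hI₁, hd₁, ht₁, ha₁, hlt₁⟩ := hx
  obtain ⟨X₂, I₂, hX₂, hy₂, hI₂, hd₂, ht₂, ha₂, hlt₂⟩ := hy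
  have hcore : G.IsSparse m (G.coreEdges F₀ I S) := hI.sparse.mono (coreEdges_subset hI.subset)
  have hdisj : Disjoint X₁ X₂ := by
    by_contra hc
    exact hxy _ (hX₁.union hcore hX₂ (Set.not_disjoint_iff_nonempty_inter.1 hc)) (Or.inl hx₁)
      (Or.inr hy₂)
  have hD := edgesIn_disjoint (G := G) hdisj
  have hm₁ (g) (hg : g ∉ G.edgesIn X₁) : g ∈ I₁ ↔ g ∈ I := by
    have := Set.ext_iff.1 hd₁ g
    simpa [hg] using this
  have hm₂ (g) (hg : g ∉ G.edgesIn X₂) : g ∈ I₂ ↔ g ∈ I := by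
    have := Set.ext_iff.1 hd₂ g
    simpa [hg] using this
  have hD₁ (g) (hg : g ∈ G.edgesIn X₁) : g ∉ G.edgesIn X₂ := Set.disjoint_left.1 hD hg
  have hD₂ (g) (hg : g ∈ G.edgesIn X₂) : g ∉ G.edgesIn X₁ := Set.disjoint_right.1 hD hg
  have htI₁ := hX₁.mono hI.sparse (coreEdges_subset hI.subset)
  have htI₂ := hX₂.mono hI.sparse (coreEdges_subset hI.subset)
  set I'' := (I₁ \ G.edgesIn X₂) ∪ (I₂ ∩ G.edgesIn X₂) with hI''
  have hsub : I'' ⊆ E(G) := Set.union_subset (Set.sdiff_subset.trans hI₁.sparse.subset)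
    (Set.inter_subset_left.trans hI₂.sparse.subset)
  have hcl₂ := ht₂.edgesIn_subset_closure hI₂.sparse
  -- Inside X₂ the edges of I₂ span everything, so replacing the piece of I₁ there loses no rank;
  -- tightness keeps the size from growing.
  have hcl : I₁ ⊆ (G.countMatroid m).closure I'' := by
    intro g hg
    by_cases hg₂ : g ∈ G.edgesIn X₂
    · exact (G.countMatroid m).closure_subset_closure Set.subset_union_right (hcl₂ hg₂)
    · exact (G.countMatroid m).mem_closure_of_mem (Or.inl ⟨hg, hg₂⟩) hsub
  have hcard₁ : I₁.ncard = I.ncard :=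
    htI₁.ncard_eq_of_sdiff_eq ht₁ hI.sparse.finite hI₁.sparse.finite hd₁
  have hcard : I''.ncard ≤ I₁.ncard := by
    refine (Set.ncard_union_le _ _).trans ?_
    have h1 := Set.ncard_inter_add_ncard_sdiff_eq_ncard I₁ (G.edgesIn X₂) hI₁.sparse.finite
    have h2 : I₁ ∩ G.edgesIn X₂ = I ∩ G.edgesIn X₂ := by
      ext g
      exact and_congr_left fun hg ↦ hm₁ g (hD₂ g hg)
    have := htI₂.eq
    have := ht₂.eq
    rw [h2] at h1
    omega
  obtain ⟨hs, hc⟩ := hI₁.sparse.isSparse_of_subset_closure hsub hcl hcard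
  have hinc₁ (v) (hv : v ∉ X₂) :
      (I'' \ F₀) ∩ G.incidenceSet v = (I₁ \ F₀) ∩ G.incidenceSet v := by
    ext g
    have hg' (hg : G.Inc g v) : g ∉ G.edgesIn X₂ := fun hg' ↦ hv (hg.mem_of_mem_edgesIn hg')
    simp only [hI'', Set.mem_inter_iff, Set.mem_sdiff, Set.mem_union, mem_incidenceSet]
    tauto
  have hinc₂ (v) (hv : v ∉ X₁) :
      (I'' \ F₀) ∩ G.incidenceSet v = (I₂ \ F₀) ∩ G.incidenceSet v := by
    ext g
    have hg' (hg : G.Inc g v) : g ∉ G.edgesIn X₁ := fun hg' ↦ hv (hg.mem_of_mem_edgesIn hg')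
    have := hm₁ g
    have := hm₂ g
    simp only [hI'', Set.mem_inter_iff, Set.mem_sdiff, Set.mem_union, mem_incidenceSet]
    tauto
  refine ⟨X₁, X₂, I'', hX₁, hX₂, hx₁, hy₂, ⟨hs, fun g hg ↦ ?_, fun v ↦ ?_⟩, hc.trans hcard₁, ?_,
    ?_, ?_, ?_, ?_⟩
  · by_cases hg₂ : g ∈ G.edgesIn X₂
    · exact Or.inr ⟨hI₂.subset hg, hg₂⟩
    · exact Or.inl ⟨hI₁.subset hg, hg₂⟩
  · by_cases hv : v ∈ X₂
    · rw [hinc₂ v (Set.disjoint_right.1 hdisj hv)]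
      exact hI₂.degree_le v
    · rw [hinc₁ v hv]
      exact hI₁.degree_le v
  · ext g
    have := hm₁ g
    simp only [hI'', Set.mem_inter_iff, Set.mem_sdiff, Set.mem_union]
    tauto
  · rintro g ⟨⟨hg, hg₂⟩ | ⟨hg, hg₂⟩, hg'⟩
    · exact ha₁ ⟨hg, hg'.resolve_right hg₂⟩
    · exact ha₂ ⟨hg, hg₂⟩
  · rwa [hinc₁ x (Set.disjoint_left.1 hdisj hx₁)]
  · rwa [hinc₂ y (Set.disjoint_right.1 hdisj hy₂)]
  · have hcl₁ : G.edgesIn X₁ ⊆ (G.countMatroid m).closure (G.coreEdges F₀ I S) :=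
      (hX₁.edgesIn_subset_closure hcore).trans
        ((G.countMatroid m).closure_subset_closure Set.inter_subset_left)
    have hcl₂ : G.edgesIn X₂ ⊆ (G.countMatroid m).closure (G.coreEdges F₀ I S) :=
      (hX₂.edgesIn_subset_closure hcore).trans
        ((G.countMatroid m).closure_subset_closure Set.inter_subset_left)
    rintro g (hg | ⟨hg, hgS⟩)
    · exact (G.countMatroid m).mem_closure_of_mem (Or.inl hg) hcore.subset
    · by_cases hg₁ : g ∈ G.edgesIn X₁
      · exact hcl₁ hg₁
      by_cases hg₂ : g ∈ G.edgesIn X₂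
      · exact hcl₂ hg₂
      refine (G.countMatroid m).mem_closure_of_mem (Or.inr ⟨?_, hgS⟩) hcore.subset
      obtain ⟨hg, -⟩ | ⟨-, hg⟩ := hg
      · exact (hm₁ g hg₁).1 hg
      · exact absurd hg hg₂

/-- Adding an edge both of whose ends have a strict degree bound keeps the degree bound. -/
lemma IsAdmissible.insert_degree_le [G.FiniteGraph] (hI : G.IsAdmissible m F₀ h I)
    (hl : G.IsLink e x y) (hx : ((I \ F₀) ∩ G.incidenceSet x).ncard < h x)
    (hy : ((I \ F₀) ∩ G.incidenceSet y).ncard < h y) (v : α) :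
    ((insert e I \ F₀) ∩ G.incidenceSet v).ncard ≤ h v := by
  have hfin : ((I \ F₀) ∩ G.incidenceSet v).Finite := hI.sparse.finite.sdiff.inter_of_left _
  by_cases hv : G.Inc e v
  · have h1 : (insert e I \ F₀) ∩ G.incidenceSet v ⊆
        insert e ((I \ F₀) ∩ G.incidenceSet v) := by
      rintro g ⟨⟨rfl | hg, hgF⟩, hgv⟩
      · exact Or.inl rfl
      · exact Or.inr ⟨⟨hg, hgF⟩, hgv⟩
    have h2 := (Set.ncard_le_ncard h1 (hfin.insert e)).trans (Set.ncard_insert_le _ _)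
    obtain rfl | rfl := hv.eq_or_eq_of_isLink hl <;> omega
  · refine le_trans (Set.ncard_le_ncard ?_ hfin) (hI.degree_le v)
    rintro g ⟨⟨rfl | hg, hgF⟩, hgv⟩
    · exact absurd hgv hv
    · exact ⟨⟨hg, hgF⟩, hgv⟩

/-- One round of adding the vertices that are not free. -/
def unfreeStep (G : Graph α β) (m : ℕ) (F₀ : Set β) (h : α → ℕ) (I : Set β) (S : Set α) : Set α :=
  S ∪ {v ∈ V(G) | ¬ G.IsFree m F₀ h I S v}

/-- The trivial exchange inside the tight set {v} is a witness; hence vertices that are not free are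
saturated. -/
lemma IsAdmissible.isFree_of_lt [G.FiniteGraph] (hI : G.IsAdmissible m F₀ h I) (hv : v ∈ V(G))
    (hlt : ((I \ F₀) ∩ G.incidenceSet v).ncard < h v) : G.IsFree m F₀ h I S v := by
  have hs := coreEdges_subset (G := G) (S := S) hI.subset
  have ht := isTight_singleton (hI.sparse.mono hs) hv
  refine ⟨{v}, I, ht, rfl, hI, rfl, ht.mono hI.sparse hs, ?_, hlt⟩
  rw [← ht.inter_eq_of_subset (ht.mono hI.sparse hs) hI.sparse.finite hs]
  exact Set.inter_subset_left.trans coreEdges_subset_union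

/-- For S = ∅ the core is all of I. An unspanned e could be added after the exchange that makes room
at both ends, against maximality. -/
lemma IsAdmissible.mem_closure_coreEdges_empty [G.FiniteGraph] (hI : G.IsAdmissible m F₀ h I)
    (hmax : ∀ I', G.IsAdmissible m F₀ h I' → I'.ncard ≤ I.ncard) (hl : G.IsLink e x y)
    (hx : G.IsFree m F₀ h I ∅ x) (hy : G.IsFree m F₀ h I ∅ y) :
    e ∈ (G.countMatroid m).closure (G.coreEdges F₀ I ∅) := by
  by_contra hcl
  have hcore : G.IsSparse m (G.coreEdges F₀ I ∅) := hI.sparse.mono (coreEdges_subset hI.subset)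
  have hxy : ∀ X, G.IsTight m (G.coreEdges F₀ I ∅) X → x ∈ X → y ∉ X := fun X hX hxX hyX ↦
    hcl ((hcore.mem_closure_iff hl.edge_mem).2 (Or.inr ⟨X, hX, hl.mem_edgesIn_iff.2 ⟨hxX, hyX⟩⟩))
  obtain ⟨X₁, X₂, I'', -, -, -, -, hI'', hcard, -, -, hltx, hlty, hsub⟩ :=
    hI.exists_exchange hx hy hxy
  have hsub' : I'' ⊆ (G.countMatroid m).closure (G.coreEdges F₀ I ∅) := fun g hg ↦
    hsub (Or.inr ⟨hg, fun v hv ↦ absurd hv (Set.notMem_empty v)⟩)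
  have he : e ∉ (G.countMatroid m).closure I'' := fun he ↦
    hcl ((G.countMatroid m).closure_subset_closure_of_subset_closure hsub' he)
  have heI : e ∉ I'' := fun heI ↦ hcl (hsub' heI)
  have hins : G.IsSparse m (insert e I'') :=
    (Matroid.Indep.insert_indep_iff_of_notMem (M := G.countMatroid m) hI''.sparse heI).2
      ⟨hl.edge_mem, he⟩
  have := hmax _ ⟨hins, hI''.subset.trans (Set.subset_insert _ _),
    hI''.insert_degree_le hl hltx hlty⟩
  rw [Set.ncard_insert_of_notMem heI hI''.sparse.finite] at this
  omega

/-- After making room at both ends of e, the larger core still spans e inside a tight set while the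
smaller one does not. So the fundamental circuit of e contains some f outside F₀ that meets S' at a
vertex z. Trading f for e lowers the degree at z, which is a witness that z is free for S. -/
lemma IsAdmissible.exists_isFree_of_notMem_closure [G.FiniteGraph]
    (hI : G.IsAdmissible m F₀ h I) (hSS' : S ⊆ S') (hl : G.IsLink e x y)
    (heS : e ∈ G.avoiding S') (hx : G.IsFree m F₀ h I S' x) (hy : G.IsFree m F₀ h I S' y)
    (hS : e ∈ (G.countMatroid m).closure (G.coreEdges F₀ I S))
    (hcl : e ∉ (G.countMatroid m).closure (G.coreEdges F₀ I S')) :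
    ∃ z ∈ S' \ S, G.IsFree m F₀ h I S z := by
  have hcore' : G.IsSparse m (G.coreEdges F₀ I S') :=
    hI.sparse.mono (coreEdges_subset hI.subset)
  have hcore : G.IsSparse m (G.coreEdges F₀ I S) :=
    hI.sparse.mono (coreEdges_subset hI.subset)
  have hxy : ∀ X, G.IsTight m (G.coreEdges F₀ I S') X → x ∈ X → y ∉ X := fun X hX hxX hyX ↦
    hcl ((hcore'.mem_closure_iff hl.edge_mem).2 (Or.inr ⟨X, hX, hl.mem_edgesIn_iff.2 ⟨hxX, hyX⟩⟩))
  obtain ⟨X₁, X₂, I'', hX₁, hX₂, hxX₁, hyX₂, hI'', hcard, hd, ha, hltx, hlty, hsub⟩ :=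
    hI.exists_exchange hx hy hxy
  have he : e ∉ (G.countMatroid m).closure (G.coreEdges F₀ I'' S') := fun he ↦
    hcl ((G.countMatroid m).closure_subset_closure_of_subset_closure hsub he)
  obtain ⟨Y, hY, heY⟩ : ∃ Y, G.IsTight m (G.coreEdges F₀ I S) Y ∧ e ∈ G.edgesIn Y := by
    refine ((hcore.mem_closure_iff hl.edge_mem).1 hS).resolve_left fun heI ↦ hcl ?_
    refine (G.countMatroid m).mem_closure_of_mem ?_ hcore'.subset
    exact heI.imp_right fun h ↦ ⟨h.1, heS⟩
  obtain ⟨hxY, hyY⟩ := hl.mem_edgesIn_iff.1 heY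
  -- X₁ and X₂ remain tight for the larger core and meet Y in x and y.
  have hX : G.IsTight m (G.coreEdges F₀ I S) (Y ∪ X₁ ∪ X₂) :=
    (hY.union hcore (hX₁.mono hcore (coreEdges_anti hSS')) ⟨x, hxY, hxX₁⟩).union hcore
      (hX₂.mono hcore (coreEdges_anti hSS')) ⟨y, Or.inl hyY, hyX₂⟩
  set X := Y ∪ X₁ ∪ X₂ with hXdef
  have hDX : G.edgesIn X₁ ∪ G.edgesIn X₂ ⊆ G.edgesIn X :=
    Set.union_subset (edgesIn_mono fun v hv ↦ Or.inl (Or.inr hv)) (edgesIn_mono fun v hv ↦ Or.inr hv)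
  have heX : e ∈ G.edgesIn X := edgesIn_mono (fun v hv ↦ Or.inl (Or.inl hv)) heY
  have hd' (g) (hg : g ∉ G.edgesIn X₁ ∪ G.edgesIn X₂) : g ∈ I'' ↔ g ∈ I := by
    have := Set.ext_iff.1 hd g
    rw [Set.mem_sdiff, Set.mem_sdiff] at this
    tauto
  have hdX : I'' \ G.edgesIn X = I \ G.edgesIn X := by
    ext g
    exact and_congr_left fun hg ↦ hd' g fun h ↦ hg (hDX h)
  have hXI : G.IsTight m I X := hX.mono hI.sparse (coreEdges_subset hI.subset)
  have hXI'' : G.IsTight m I'' X :=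
    hXI.of_sdiff_eq hI.sparse.finite hI''.sparse.finite hcard hdX
  have haX : I'' ∩ G.edgesIn X ⊆ F₀ ∪ G.avoiding S := by
    rintro g ⟨hg, hgX⟩
    by_cases hg' : g ∈ G.edgesIn X₁ ∪ G.edgesIn X₂
    · exact (ha ⟨hg, hg'⟩).imp_right fun h ↦ avoiding_anti hSS' h
    · have : g ∈ I ∩ G.edgesIn X := ⟨(hd' g hg').1 hg, hgX⟩
      rw [← hX.inter_eq_of_subset hXI hI.sparse.finite (coreEdges_subset hI.subset)] at this
      exact coreEdges_subset_union this.1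
  have heI : e ∉ I'' := fun heI ↦ he ((G.countMatroid m).mem_closure_of_mem (Or.inr ⟨heI, heS⟩)
    ((coreEdges_subset hI''.subset).trans hI''.sparse.subset))
  have hK : (G.countMatroid m).Indep (I'' ∩ G.edgesIn X) :=
    hI''.sparse.mono Set.inter_subset_left
  have heK := hXI''.edgesIn_subset_closure hI''.sparse heX
  have hC := hK.fundCircuit_isCircuit heK fun h ↦ heI h.1
  have hCsub := (G.countMatroid m).fundCircuit_subset_insert e (I'' ∩ G.edgesIn X)
  have heC := (G.countMatroid m).mem_fundCircuit e (I'' ∩ G.edgesIn X)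
  have hCeq := hC.eq_fundCircuit_of_subset (I := I'') hI''.sparse
    (hCsub.trans (Set.insert_subset_insert Set.inter_subset_left))
  have hecl : e ∈ (G.countMatroid m).closure I'' :=
    (G.countMatroid m).closure_subset_closure Set.inter_subset_left heK
  obtain ⟨f, ⟨hfC, hfe⟩, hfcore⟩ : ∃ f ∈ (G.countMatroid m).fundCircuit e (I'' ∩ G.edgesIn X) \ {e},
      f ∉ G.coreEdges F₀ I'' S' := by
    by_contra! hc
    exact he ((G.countMatroid m).closure_subset_closure hc
      (hC.mem_closure_sdiff_singleton_of_mem heC))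
  have hfe : f ≠ e := hfe
  obtain ⟨hfI, hfX⟩ : f ∈ I'' ∩ G.edgesIn X := (hCsub hfC).resolve_left hfe
  have hfF : f ∉ F₀ := fun h ↦ hfcore (Or.inl h)
  obtain ⟨z, hzS', hfz⟩ : ∃ z ∈ S', G.Inc f z := by
    by_contra! hc
    exact hfcore (Or.inr ⟨hfI, hc⟩)
  -- All edges of I'' inside X lie in F₀ or avoid S, and f is not in F₀.
  have hzS : z ∉ S := fun hz ↦ (haX ⟨hfI, hfX⟩).elim hfF fun h ↦ h z hz hfz
  have hsp : G.IsSparse m (insert e I'' \ {f}) := by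
    rw [hCeq] at hfC
    exact (Matroid.Indep.mem_fundCircuit_iff (M := G.countMatroid m) hI''.sparse hecl heI).1 hfC
  have hfin := hI''.sparse.finite
  have hdX' : (insert e I'' \ {f}) \ G.edgesIn X = I'' \ G.edgesIn X := by
    ext g
    simp only [Set.mem_sdiff, Set.mem_insert_iff, Set.mem_singleton_iff]
    refine and_congr_left fun hg ↦ ⟨?_, fun h ↦ ⟨Or.inr h, ?_⟩⟩
    · rintro ⟨rfl | h, -⟩
      · exact absurd heX hg
      · exact h
    · rintro rfl
      exact hg hfX
  have hcard' : (insert e I'' \ {f}).ncard = I''.ncard := by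
    rw [Set.ncard_sdiff_singleton_of_mem (Set.mem_insert_of_mem e hfI), Set.ncard_insert_of_notMem heI hfin]
    rfl
  refine ⟨z, ⟨hzS', hzS⟩, X, insert e I'' \ {f}, hX, hfz.mem_of_mem_edgesIn hfX,
    ⟨hsp, fun g hg ↦ ⟨Or.inr (hI''.subset hg), ?_⟩, fun v ↦ ?_⟩, hdX'.trans hdX,
    hXI''.of_sdiff_eq hfin hsp.finite hcard' hdX', ?_, ?_⟩
  · rintro rfl
    exact hfF hg
  · refine le_trans (Set.ncard_le_ncard ?_ ?_) (hI''.insert_degree_le hl hltx hlty v)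
    · exact Set.inter_subset_inter_left _ (Set.sdiff_subset_sdiff_left Set.sdiff_subset)
    · exact (hfin.insert e).sdiff.inter_of_left _
  · rintro g ⟨⟨rfl | hg, -⟩, hgX⟩
    · exact Or.inr (avoiding_anti hSS' heS)
    · exact haX ⟨hg, hgX⟩
  -- The degree at z drops by the loss of f; e avoids S' and so adds nothing there.
  · refine lt_of_lt_of_le (Set.ncard_lt_ncard ⟨?_, fun hc ↦ ?_⟩ (hfin.sdiff.inter_of_left _))
      (hI''.degree_le z)
    · rintro g ⟨⟨⟨rfl | hg, -⟩, hgF⟩, hgz⟩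
      · exact absurd hgz (heS z hzS')
      · exact ⟨⟨hg, hgF⟩, hgz⟩
    · exact (hc ⟨⟨hfI, hfF⟩, hfz⟩ : f ∈ _).1.1.2 rfl

/-- For an admissible set of maximum size there is a set `S` of vertices at which the degree bound
is attained, such that the core with respect to `S` spans every edge avoiding `S`. -/
theorem IsAdmissible.exists_saturated [G.FiniteGraph] (hI : G.IsAdmissible m F₀ h I)
    (hmax : ∀ I', G.IsAdmissible m F₀ h I' → I'.ncard ≤ I.ncard) :
    ∃ S ⊆ V(G), (∀ v ∈ S, h v ≤ ((I \ F₀) ∩ G.incidenceSet v).ncard) ∧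
      E(G) ∩ G.avoiding S ⊆ (G.countMatroid m).closure (G.coreEdges F₀ I S) := by
  -- Starting from ∅, the non-free vertices are added repeatedly; by finiteness the chain
  -- stabilises, and its last member is S.
  set Φ := G.unfreeStep m F₀ h I with hΦ
  set s : ℕ → Set α := fun n ↦ Φ^[n] ∅ with hs
  have hsucc (n) : s (n + 1) = s n ∪ {v ∈ V(G) | ¬ G.IsFree m F₀ h I (s n) v} := by
    simp only [hs, Function.iterate_succ_apply']
    rfl
  have hmono : Monotone s := monotone_nat_of_le_succ fun n ↦ by
    rw [hsucc]
    exact Set.subset_union_left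
  have hsV (n) : s n ⊆ V(G) := by
    induction n with
    | zero => exact Set.empty_subset _
    | succ n ih =>
      rw [hsucc]
      exact Set.union_subset ih fun v hv ↦ hv.1
  have hsdeg (n) : ∀ v ∈ s n, h v ≤ ((I \ F₀) ∩ G.incidenceSet v).ncard := by
    induction n with
    | zero => exact fun v hv ↦ absurd hv (Set.notMem_empty v)
    | succ n ih =>
      rw [hsucc]
      rintro v (hv | ⟨hv, hfree⟩)
      · exact ih v hv
      · by_contra! hlt
        exact hfree (hI.isFree_of_lt hv hlt)
  obtain ⟨N, hN⟩ : ∃ N, ∀ n, s n ⊆ s N := by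
    have hfin : (Set.range s).Finite :=
      FiniteGraph.vertexSet_finite.finite_subsets.subset (Set.range_subset_iff.2 hsV)
    obtain ⟨_, ⟨⟨N, rfl⟩, hN⟩⟩ := hfin.exists_maximal (Set.range_nonempty s)
    refine ⟨N, fun n ↦ ?_⟩
    have := hN ⟨max n N, rfl⟩ (hmono (le_max_right n N))
    exact (hmono (le_max_left n N)).trans this
  refine ⟨s N, hsV N, hsdeg N, fun e he ↦ ?_⟩
  obtain ⟨x, y, hl⟩ := exists_isLink_of_mem_edgeSet he.1
  have hfree (n) (v) (hv : v ∈ V(G)) (hev : G.Inc e v) : G.IsFree m F₀ h I (s n) v := by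
    by_contra hc
    refine he.2 v (hN (n + 1) ?_) hev
    rw [hsucc]
    exact Or.inr ⟨hv, hc⟩
  have hx (n) := hfree n x hl.left_mem hl.inc_left
  have hy (n) := hfree n y hl.right_mem hl.inc_right
  -- If e left the closure at stage n + 1, some vertex added there would have been free at stage n.
  have key (n) : e ∈ (G.countMatroid m).closure (G.coreEdges F₀ I (s n)) := by
    induction n with
    | zero => exact hI.mem_closure_coreEdges_empty hmax hl (hx 0) (hy 0)
    | succ n ih =>
      by_contra hcl
      obtain ⟨z, ⟨hz, hz'⟩, hzf⟩ := hI.exists_isFree_of_notMem_closure (hmono n.le_succ) hl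
        (avoiding_anti (hN (n + 1)) he.2) (hx (n + 1)) (hy (n + 1)) ih hcl
      rw [Nat.succ_eq_add_one, hsucc] at hz
      exact (hz.resolve_left hz').2 hzf
  exact key N

end Graph

/-! ### Edge counts around the saturated set. -/

namespace Graph

variable {α β : Type*} {G F : Graph α β} {m : ℕ} {F₀ I J B : Set β} {X Y C : Set α}
  {h : α → ℕ} {e f : β} {x y v : α}

open Classical in
lemma sum_ncard_inter_eq_sum_card_filter {ι : Type*} (A : Finset β) (Q : Finset ι)
    (f : ι → Set β) :
    ∑ i ∈ Q, ((A : Set β) ∩ f i).ncard = ∑ e ∈ A, (Q.filter fun i ↦ e ∈ f i).card := by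
  have hc (i) : ((A : Set β) ∩ f i).ncard = (A.filter fun e ↦ e ∈ f i).card := by
    rw [← Set.ncard_coe_finset]
    congr 1
    ext e
    simp
  simp only [hc]
  exact Finset.sum_card_bipartiteAbove_eq_sum_card_bipartiteBelow fun i e ↦ e ∈ f i

open Classical in
lemma ncard_inter_eq_sum_ite (A : Finset β) (X : Set β) :
    ((A : Set β) ∩ X).ncard = ∑ e ∈ A, if e ∈ X then 1 else 0 := by
  rw [← Finset.card_filter, ← Set.ncard_coe_finset]
  congr 1
  ext e
  simp

/-- An edge meeting S is counted once, or twice if both ends are in S, and then it also appears in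
`edgesIn`. -/
lemma sum_ncard_incidenceSet_le (hB : B ⊆ E(G)) (hfin : B.Finite) (S : Finset α) :
    ∑ v ∈ S, (B ∩ G.incidenceSet v).ncard ≤
      (B \ G.avoiding S).ncard + (B ∩ G.edgesIn S).ncard := by
  classical
  lift B to Finset β using hfin
  rw [sum_ncard_inter_eq_sum_card_filter, Set.sdiff_eq, ncard_inter_eq_sum_ite,
    ncard_inter_eq_sum_ite, ← Finset.sum_add_distrib]
  refine Finset.sum_le_sum fun e he ↦ ?_
  obtain ⟨x, y, hl⟩ := exists_isLink_of_mem_edgeSet (hB he)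
  have hsub : (S.filter fun v ↦ e ∈ G.incidenceSet v) ⊆ {x, y} := fun v hv ↦ by
    simpa using Inc.eq_or_eq_of_isLink (Finset.mem_filter.1 hv).2 hl
  have h2 : (S.filter fun v ↦ e ∈ G.incidenceSet v).card ≤ 2 :=
    (Finset.card_le_card hsub).trans Finset.card_le_two
  by_cases hin : e ∈ G.edgesIn S
  · have hav : e ∈ (G.avoiding S)ᶜ := fun ha ↦ ha x (hl.mem_edgesIn_iff.1 hin).1 hl.inc_left
    simpa [hin, hav] using h2
  · simp only [hin, if_false, add_zero]
    split_ifs with hav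
    · refine Finset.card_le_one.2 fun a ha b hb ↦ ?_
      by_contra hab
      obtain ⟨haS, ha⟩ := Finset.mem_filter.1 ha
      obtain ⟨hbS, hb⟩ := Finset.mem_filter.1 hb
      refine hin (hl.mem_edgesIn_iff.2 ?_)
      obtain rfl | rfl := Inc.eq_or_eq_of_isLink ha hl <;>
        obtain rfl | rfl := Inc.eq_or_eq_of_isLink hb hl
      · exact absurd rfl hab
      · exact ⟨haS, hbS⟩
      · exact ⟨hbS, haS⟩
      · exact absurd rfl hab
    · rw [Nat.le_zero, Finset.card_eq_zero, Finset.filter_eq_empty_iff]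
      exact fun v hv ↦ (not_not.1 hav) v hv

lemma two_mul_ncard_inter_edgesIn_le (hloop : G.Loopless) (hfin : B.Finite) (S : Finset α) :
    2 * (B ∩ G.edgesIn S).ncard ≤ ∑ v ∈ S, (B ∩ G.incidenceSet v).ncard := by
  classical
  lift B to Finset β using hfin
  rw [sum_ncard_inter_eq_sum_card_filter, ncard_inter_eq_sum_ite, Finset.mul_sum]
  refine Finset.sum_le_sum fun e _ ↦ ?_
  split_ifs with hin
  · obtain ⟨x, y, hl, hx, hy⟩ := hin
    rw [mul_one, ← Finset.card_pair hl.ne]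
    refine Finset.card_le_card fun v hv ↦ ?_
    rw [Finset.mem_insert, Finset.mem_singleton] at hv
    obtain rfl | rfl := hv
    · exact Finset.mem_filter.2 ⟨hx, hl.inc_left⟩
    · exact Finset.mem_filter.2 ⟨hy, hl.inc_right⟩
  · simp

/-- An edge leaves at most two members of a disjoint family. -/
lemma sum_boundaryDegree_le (Q : Finset (Set α)) (hQ : (Q : Set (Set α)).PairwiseDisjoint id)
    (hfin : J.Finite) (hJ : ∀ C ∈ Q, ∀ e x y, F.IsLink e x y → x ∈ C → y ∉ C → e ∈ J)  :
    ∑ C ∈ Q, F.boundaryDegree C ≤ 2 * J.ncard := by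
  classical
  lift J to Finset β using hfin
  set f : Set α → Set β := fun C ↦ {e | ∃ x y, F.IsLink e x y ∧ x ∈ C ∧ y ∉ C} with hf
  have heq : ∑ C ∈ Q, F.boundaryDegree C = ∑ C ∈ Q, ((J : Set β) ∩ f C).ncard := by
    refine Finset.sum_congr rfl fun C hC ↦ ?_
    rw [Set.inter_eq_self_of_subset_right]
    · rfl
    · rintro e ⟨x, y, hl, hx, hy⟩
      exact hJ C hC e x y hl hx hy
  rw [heq, sum_ncard_inter_eq_sum_card_filter, Set.ncard_coe_finset, mul_comm, ← smul_eq_mul]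
  refine Finset.sum_le_card_nsmul _ _ _ fun e _ ↦ ?_
  have hone (x : α) : (Q.filter fun C ↦ x ∈ C).card ≤ 1 := by
    refine Finset.card_le_one.2 fun C hC D hD ↦ ?_
    obtain ⟨hC, hxC⟩ := Finset.mem_filter.1 hC
    obtain ⟨hD, hxD⟩ := Finset.mem_filter.1 hD
    by_contra hne
    exact Set.disjoint_left.1 (hQ hC hD hne) hxC hxD
  by_cases he : e ∈ E(F)
  · obtain ⟨x, y, hl⟩ := exists_isLink_of_mem_edgeSet he
    have hsub : (Q.filter fun C ↦ e ∈ f C) ⊆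
        (Q.filter fun C ↦ x ∈ C) ∪ (Q.filter fun C ↦ y ∈ C) := by
      intro C hC
      obtain ⟨hCQ, u, v, hl', hu, -⟩ := Finset.mem_filter.1 hC
      rw [Finset.mem_union, Finset.mem_filter, Finset.mem_filter]
      obtain rfl | rfl := hl'.left_eq_or_eq hl
      · exact Or.inl ⟨hCQ, hu⟩
      · exact Or.inr ⟨hCQ, hu⟩
    have := (Finset.card_le_card hsub).trans (Finset.card_union_le _ _)
    have := hone x
    have := hone y
    omega
  · rw [Finset.filter_false_of_mem]
    · simp
    · rintro C - ⟨x, y, hl, -⟩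
      exact he hl.edge_mem

section Core

variable {S : Set α}

lemma mem_edgesIn_notMem_avoiding (he : e ∈ G.edgesIn X) (hX : X ⊆ S) : e ∉ G.avoiding S := by
  obtain ⟨x, y, hl, hx, -⟩ := he
  exact fun h ↦ h x (hX hx) hl.inc_left

/-- Edges inside S meet S, so the core keeps only F₀ there. -/
lemma coreEdges_inter_edgesIn_subset (hX : X ⊆ S) :
    G.coreEdges F₀ I S ∩ G.edgesIn X ⊆ F₀ := by
  rintro e ⟨he | he, heX⟩
  · exact he
  · exact absurd he.2 (mem_edgesIn_notMem_avoiding heX hX)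

/-- A maximal tight set of the core that lies inside `S` is a component of `F`. -/
lemma mem_treeComponents_of_mem_tightParts [G.FiniteGraph] (hm : 1 ≤ m) (hF : F ≤s G)
    (hF₀F : F₀ ⊆ E(F)) (hcl : E(F) ⊆ (G.countMatroid m).closure F₀)
    (hJ : G.IsSparse m (G.coreEdges F₀ I S)) (hC : C ∈ G.tightParts m (G.coreEdges F₀ I S))
    (hCS : C ⊆ S) : C ∈ F.treeComponents m := by
  have hFfin : F.FiniteGraph := .of_le hF.le
  have hs : G.IsSparse m F₀ := hJ.mono Set.subset_union_left
  have hsF : F.IsSparse m F₀ := (isSparse_iff_of_le hF.le).2 ⟨hs, hF₀F⟩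
  have hV := hF.vertexSet_eq
  have htight (X) (hX : X ⊆ V(G)) : F.IsTight m F₀ X ↔ G.IsTight m F₀ X :=
    isTight_iff_of_le hF.le hF₀F (hX.trans hV.ge)
  have hclF : E(F) ⊆ (F.countMatroid m).closure F₀ := fun e he ↦ by
    rw [hsF.mem_closure_iff he]
    refine ((hs.mem_closure_iff (hF.le.edgeSet_mono he)).1 (hcl he)).imp_right ?_
    rintro ⟨X, hX, heX⟩
    exact ⟨X, (htight X hX.subset).2 hX, by rw [edgesIn_of_le hF.le]; exact ⟨heX, he⟩⟩
  rw [treeComponents_eq hm hsF hclF, SetLike.mem_coe, mem_tightParts]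
  have hC := mem_tightParts.1 hC
  have hCeq : F₀ ∩ G.edgesIn C = G.coreEdges F₀ I S ∩ G.edgesIn C :=
    (Set.inter_subset_inter_left _ Set.subset_union_left).antisymm fun e he ↦
      ⟨coreEdges_inter_edgesIn_subset hCS he, he.2⟩
  refine ⟨(htight C hC.prop.subset).2 ⟨hC.prop.subset, hC.prop.nonempty, ?_⟩, fun Z hZ hle ↦ ?_⟩
  · rw [hCeq, hC.prop.eq]
  · have hZ' := (htight Z (hZ.subset.trans hV.le)).1 hZ
    exact hC.le_of_ge (hZ'.mono hJ Set.subset_union_left) hle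

open Classical in
/-- The maximal tight sets of the core that are contained in `S`. -/
noncomputable def innerParts (G : Graph α β) [G.FiniteGraph] (m : ℕ) (J : Set β) (S : Set α) :
    Finset (Set α) :=
  (G.tightParts m J).filter fun C ↦ C ⊆ S

lemma mem_innerParts [G.FiniteGraph] :
    C ∈ G.innerParts m J S ↔ C ∈ G.tightParts m J ∧ C ⊆ S := by
  simp [innerParts]

/-- The traces outside `S` of the blocks not contained in `S` form a partition of `G \ S`. -/
lemma isVertexPartition_deleteVerts [G.FiniteGraph] [DecidableEq (Set α)]
    {P Q : Finset (Set α)} (hP : G.IsVertexPartition P) (hQ : ∀ X, X ∈ Q ↔ X ∈ P ∧ ¬ X ⊆ S) :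
    (G.deleteVerts S).IsVertexPartition (Q.image fun X ↦ X \ S) ∧
      (Q.image fun X ↦ X \ S).card = Q.card := by
  have hdisj : ∀ X ∈ Q, ∀ Y ∈ Q, ∀ x, x ∈ X \ S → x ∈ Y \ S → X = Y := fun X hX Y hY x hx hy ↦
    hP.eq_of_mem ((hQ X).1 hX).1 ((hQ Y).1 hY).1 hx.1 hy.1
  have hne : ∀ X ∈ Q, (X \ S).Nonempty := fun X hX ↦ Set.sdiff_nonempty.2 ((hQ X).1 hX).2
  refine ⟨⟨?_, ?_, ?_, ?_⟩, Finset.card_image_of_injOn ?_⟩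
  · intro Z hZ
    obtain ⟨X, hX, rfl⟩ := Finset.mem_image.1 hZ
    rw [vertexSet_deleteVerts]
    exact Set.sdiff_subset_sdiff_left (hP.subset X ((hQ X).1 hX).1)
  · intro Z hZ
    obtain ⟨X, hX, rfl⟩ := Finset.mem_image.1 hZ
    exact hne X hX
  · intro Z hZ W hW hZW
    obtain ⟨X, hX, rfl⟩ := Finset.mem_image.1 hZ
    obtain ⟨Y, hY, rfl⟩ := Finset.mem_image.1 hW
    refine Set.disjoint_left.2 fun x hx hy ↦ hZW ?_
    rw [hdisj X hX Y hY x hx hy]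
  · intro x hx
    rw [vertexSet_deleteVerts] at hx
    obtain ⟨X, hX, hxX⟩ := hP.cover x hx.1
    exact ⟨X \ S, Finset.mem_image_of_mem _ ((hQ X).2 ⟨hX, fun h ↦ hx.2 (h hxX)⟩), hxX, hx.2⟩
  · intro X hX Y hY hXY
    obtain ⟨x, hx⟩ := hne X hX
    exact hdisj X hX Y hY x hx ((show X \ S = Y \ S from hXY) ▸ hx)

/-- With P the maximal J-tight sets and A the edges of J between them, m|V| - |J| = m|P| - |A|.
Blocks not inside S leave a partition of G \ S whose crossing edges, spanned by J, lie in A and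
avoid S; this bounds Ω(G \ S) from below. Boundary edges of F at blocks inside S lie in A and meet
S, each counted at most twice. The factor 2 keeps the half-degrees integral. -/
lemma card_mul_sub_le_omega_deleteVerts [G.FiniteGraph] (hm : 1 ≤ m) (hF : F ≤s G)
    (hcl : E(F) ⊆ (G.countMatroid m).closure F₀) (hI : G.IsSparse m I) (hF₀ : F₀ ⊆ I)
    (hS : E(G) ∩ G.avoiding S ⊆ (G.countMatroid m).closure (G.coreEdges F₀ I S)) :
    2 * ((m : ℤ) * V(G).ncard - (G.coreEdges F₀ I S).ncard) +
        ∑ C ∈ G.innerParts m (G.coreEdges F₀ I S) S, (F.boundaryDegree C : ℤ) ≤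
      2 * (G.deleteVerts S).Omega m +
        2 * (m * (G.innerParts m (G.coreEdges F₀ I S) S).card) := by
  classical
  set J := G.coreEdges F₀ I S with hJdef
  have hJ : G.IsSparse m J := hI.mono (coreEdges_subset hF₀)
  have hP := isVertexPartition_tightParts hJ
  set P := G.tightParts m J with hPdef
  set Q := P.filter fun C ↦ ¬ C ⊆ S with hQdef
  obtain ⟨hP', hcard⟩ := isVertexPartition_deleteVerts (S := S) (Q := Q) hP fun X ↦ by
    simp [hQdef]
  set P' := Q.image fun X ↦ X \ S with hP'def
  have hsplit : (G.innerParts m J S).card + Q.card = P.card :=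
    Finset.card_filter_add_card_filter_not _
  have hfg : (G.deleteVerts S).FiniteGraph := .of_le deleteVerts_le
  obtain ⟨K, hK, hΩ⟩ := exists_isSparse_omega_eq (G := G.deleteVerts S) hm
  have h1 := hK.ncard_add_mul_card_le hP'
  have h2 := hJ.ncard_add_mul_card_tightParts
  have hcrossJ : (G.countMatroid m).closure J ∩ G.crossingEdges P ⊆ J :=
    crossingEdges_tightParts_subset hJ
  have hFI : E(F) ⊆ (G.countMatroid m).closure J :=
    hcl.trans ((G.countMatroid m).closure_subset_closure Set.subset_union_left)
  set A := J ∩ G.crossingEdges P with hA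
  have hAfin : A.Finite := hJ.finite.inter_of_left _
  have h3 : K ∩ (G.deleteVerts S).crossingEdges P' ⊆ A ∩ G.avoiding S := by
    rintro e ⟨-, x, y, hl, Z, hZ, W, hW, hne, hx, hy⟩
    obtain ⟨X, hX, rfl⟩ := Finset.mem_image.1 hZ
    obtain ⟨Y, hY, rfl⟩ := Finset.mem_image.1 hW
    have hlG : G.IsLink e x y := hl.mono deleteVerts_le
    have hav : e ∈ G.avoiding S := by
      rintro v hv hev
      obtain rfl | rfl := hev.eq_or_eq_of_isLink hlG
      · exact hx.2 hv
      · exact hy.2 hv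
    have hcr : e ∈ G.crossingEdges P := by
      refine ⟨x, y, hlG, X, (Finset.mem_filter.1 hX).1, Y, (Finset.mem_filter.1 hY).1, ?_, hx.1,
        hy.1⟩
      rintro rfl
      exact hne rfl
    exact ⟨⟨hcrossJ ⟨hS ⟨hlG.edge_mem, hav⟩, hcr⟩, hcr⟩, hav⟩
  have h4 : ∑ C ∈ G.innerParts m J S, F.boundaryDegree C ≤ 2 * (A \ G.avoiding S).ncard := by
    refine sum_boundaryDegree_le _ ?_ hAfin.sdiff ?_
    · exact hP.disjoint.subset fun C hC ↦ (mem_innerParts.1 hC).1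
    · intro C hC e x y hl hx hy
      obtain ⟨hCP, hCS⟩ := mem_innerParts.1 hC
      have hlG := hl.mono hF.le
      have hcr : e ∈ G.crossingEdges P := by
        obtain ⟨D, hD, hyD⟩ := hP.cover y hlG.right_mem
        refine ⟨x, y, hlG, C, hCP, D, hD, ?_, hx, hyD⟩
        rintro rfl
        exact hy hyD
      exact ⟨⟨hcrossJ ⟨hFI hl.edge_mem, hcr⟩, hcr⟩, fun hav ↦ hav x (hCS hx) hlG.inc_left⟩
  have h5 := Set.ncard_inter_add_ncard_sdiff_eq_ncard A (G.avoiding S) hAfin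
  have h6 := Set.ncard_le_ncard h3 (hAfin.inter_of_left _)
  rw [hΩ]
  rw [hcard] at h1
  rw [← hsplit] at h2
  zify at h1 h2 h4 h5 h6
  rw [mul_add] at h2
  linarith

/-- The F₀-edges in the tight blocks inside S and the edges of I \ F₀ inside S are disjoint parts of
one sparse set of G[S]. -/
lemma omega_induce_add_le [G.FiniteGraph] (hm : 1 ≤ m) (hSV : S ⊆ V(G)) (hI : G.IsSparse m I)
    (hF₀ : F₀ ⊆ I) :
    (G.induce S).Omega m + (∑ C ∈ G.innerParts m (G.coreEdges F₀ I S) S, ((m : ℤ) * (C.ncard - 1)) +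
      ((I \ F₀) ∩ G.edgesIn S).ncard) ≤ m * S.ncard := by
  classical
  have hfg : (G.induce S).FiniteGraph := .of_le (induce_le hSV)
  set J := G.coreEdges F₀ I S with hJdef
  have hJ : G.IsSparse m J := hI.mono (coreEdges_subset hF₀)
  have hP := isVertexPartition_tightParts hJ
  set Q := G.innerParts m J S with hQ
  set U : Set β := ⋃ C ∈ Q, J ∩ G.edgesIn C with hU
  have hUF : U ⊆ F₀ := Set.iUnion₂_subset fun C hC ↦
    coreEdges_inter_edgesIn_subset (mem_innerParts.1 hC).2
  have hUS : U ⊆ G.edgesIn S := Set.iUnion₂_subset fun C hC ↦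
    Set.inter_subset_right.trans (edgesIn_mono (mem_innerParts.1 hC).2)
  have hUcard : U.ncard = ∑ C ∈ Q, (J ∩ G.edgesIn C).ncard :=
    ncard_biUnion_finset _ _ (fun C _ ↦ hJ.finite.inter_of_left _) fun C hC D hD hne ↦
      (edgesIn_disjoint (hP.disjoint (mem_innerParts.1 hC).1 (mem_innerParts.1 hD).1 hne)).mono
        Set.inter_subset_right Set.inter_subset_right
  have hsp : (G.induce S).IsSparse m (U ∪ ((I \ F₀) ∩ G.edgesIn S)) := by
    rw [isSparse_iff_of_le (induce_le hSV)]
    refine ⟨hI.mono (Set.union_subset (hUF.trans hF₀) ?_),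
      Set.union_subset hUS Set.inter_subset_right⟩
    exact Set.inter_subset_left.trans Set.sdiff_subset
  have hΩ := hsp.omega_le hm
  rw [Set.ncard_union_eq ?_ (hI.finite.subset (hUF.trans hF₀)) (hI.finite.sdiff.inter_of_left _),
    hUcard] at hΩ
  · have hsum : ∑ C ∈ Q, ((J ∩ G.edgesIn C).ncard : ℤ) = ∑ C ∈ Q, ((m : ℤ) * (C.ncard - 1)) := by
      refine Finset.sum_congr rfl fun C hC ↦ ?_
      have := (mem_tightParts.1 (mem_innerParts.1 hC).1).prop.eq
      zify at this
      linarith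
    have hV : V(G.induce S) = S := rfl
    rw [hV] at hΩ
    push_cast at hΩ
    rw [hsum] at hΩ
    linarith
  · exact Set.disjoint_left.2 fun e he he' ↦ he'.1.2 (hUF he)

end Core

end Graph

/-! ### The extremal set and the final estimate. -/

namespace Graph

variable {α β : Type*} {G F : Graph α β} {m : ℕ} {F₀ I : Set β} {h : α → ℕ} {S : Set α}

lemma exists_isAdmissible_maximal [G.FiniteGraph] (hF₀ : G.IsSparse m F₀) (h : α → ℕ) :
    ∃ I, G.IsAdmissible m F₀ h I ∧ ∀ I', G.IsAdmissible m F₀ h I' → I'.ncard ≤ I.ncard := by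
  have hfin : {I | G.IsAdmissible m F₀ h I}.Finite :=
    FiniteGraph.edgeSet_finite.finite_subsets.subset fun I hI ↦ hI.sparse.subset
  obtain ⟨I, hI, hmax⟩ := Set.exists_max_image _ Set.ncard hfin
    ⟨F₀, hF₀, subset_rfl, fun v ↦ by simp⟩
  exact ⟨I, hI, hmax⟩

lemma IsAdmissible.exists_factor [G.FiniteGraph] (hm : 1 ≤ m) (hne : V(G).Nonempty) (hF : F ≤s G)
    (hF₀F : F₀ ⊆ E(F)) (hI : G.IsAdmissible m F₀ h I) (hcard : I.ncard + m = m * V(G).ncard) :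
    ∃ H : Graph α β, H ≤s G ∧ F ≤ H ∧ H.IsTreeConnected m ∧
      ∀ v ∈ V(G), H.vertexDegree v ≤ h v + F.vertexDegree v := by
  have hle : G.restrict (E(F) ∪ I) ≤ G := restrict_le
  have hfg : (G.restrict (E(F) ∪ I)).FiniteGraph := .of_le hle
  have hIH : (G.restrict (E(F) ∪ I)).IsSparse m I :=
    (isSparse_iff_of_le hle).2 ⟨hI.sparse, fun e he ↦ ⟨hI.sparse.subset he, Or.inr he⟩⟩
  refine ⟨G.restrict (E(F) ∪ I), ⟨hle, rfl⟩, ⟨hF.le.vertexSet_mono, fun e x y hl ↦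
    ⟨Or.inl hl.edge_mem, hl.mono hF.le⟩⟩, (isTreeConnected_iff hm).2 ⟨hne, I, hIH, hcard⟩,
    fun v _ ↦ ?_⟩
  have hsub : (G.restrict (E(F) ∪ I)).incidenceSet v ⊆
      ((I \ F₀) ∩ G.incidenceSet v) ∪ F.incidenceSet v := by
    intro e he
    obtain ⟨hev, he⟩ := restrict_inc.1 ((mem_incidenceSet _ _).1 he)
    by_cases heF : e ∈ E(F)
    · exact Or.inr ((hF.le.inc_congr heF).2 hev)
    · exact Or.inl ⟨⟨he.resolve_left heF, fun h0 ↦ heF (hF₀F h0)⟩, hev⟩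
  have hfin : (((I \ F₀) ∩ G.incidenceSet v) ∪ F.incidenceSet v).Finite :=
    (hI.sparse.finite.sdiff.inter_of_left _).union
      (finite_of_subset_edgeSet ((F.incidenceSet_subset_edgeSet v).trans hF.le.edgeSet_mono))
  calc _ ≤ _ := Set.ncard_le_ncard hsub hfin
    _ ≤ _ := Set.ncard_union_le _ _
    _ ≤ _ := Nat.add_le_add_right (hI.degree_le v) _

/-- Passing from I to the core loses exactly the edges of I \ F₀ that meet S; counting them by their
ends in S counts those inside S twice. -/
lemma sum_degree_le [G.FiniteGraph] (hI : G.IsAdmissible m F₀ h I) (S : Finset α)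
    (hS : ∀ v ∈ S, h v ≤ ((I \ F₀) ∩ G.incidenceSet v).ncard) :
    ∑ v ∈ S, h v + (G.coreEdges F₀ I S).ncard ≤
      I.ncard + ((I \ F₀) ∩ G.edgesIn S).ncard := by
  have h1 := Finset.sum_le_sum hS
  have h2 := sum_ncard_incidenceSet_le (G := G) (B := I \ F₀)
    (Set.sdiff_subset.trans hI.sparse.subset) hI.sparse.finite.sdiff S
  have h3 : (I \ F₀) \ G.avoiding S = I \ G.coreEdges F₀ I S := by
    ext e
    simp only [coreEdges, Set.mem_sdiff, Set.mem_union, Set.mem_inter_iff]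
    tauto
  have h4 := Set.ncard_sdiff_add_ncard_of_subset (coreEdges_subset (G := G) (S := S) hI.subset)
    hI.sparse.finite
  rw [h3] at h2
  omega

end Graph

theorem mainTheorem5 {α β : Type*} (G F : Graph α β)
    (hVfin : V(G).Finite) (hEfin : E(G).Finite) (hne : V(G).Nonempty) (hloop : G.Loopless)
    (m : ℕ) (hm : 1 ≤ m)
    (hF : F ≤s G)
    (h : α → ℕ)
    (c : ℝ) (hc : 2 ≤ c)
    (ξ : α → ℝ) (hξ : ∀ v ∈ V(G), 0 ≤ ξ v ∧ ξ v ≤ (m : ℝ))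
    (hcomp : ∀ C : Finset α, (C : Set α) ∈ F.treeComponents m →
      (m : ℝ) - (m : ℝ) / (c - 1) * ((C.card : ℝ) - 1)
          - 1 / 2 * (F.boundaryDegree (C : Set α) : ℝ)
        ≤ ∑ v ∈ C, ξ v)
    (htough : ∀ S : Finset α, (S : Set α) ⊆ V(G) →
      ((G.deleteVerts (S : Set α)).Omega m : ℝ) <
        ∑ v ∈ S, ((h v : ℝ) - (m : ℝ) / (c - 1) - ξ v) + (m : ℝ) + 1
          + 1 / (c - 1) * ((G.induce (S : Set α)).Omega m : ℝ)
          - (c - 2) / (c - 1) *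
              min ((⌊∑ v ∈ S, (h v : ℝ) / 2⌋ : ℤ) : ℝ)
                ((m : ℝ) * (S.card : ℝ) - ((G.induce (S : Set α)).Omega m : ℝ))) :
    ∃ H : Graph α β, H ≤s G ∧ F ≤ H ∧ H.IsTreeConnected m ∧
      ∀ v ∈ V(G), H.vertexDegree v ≤ h v + F.vertexDegree v := by
  classical
  have hfg : G.FiniteGraph := ⟨hVfin, hEfin⟩
  obtain ⟨F₀, hF₀, hF₀F, hcl⟩ := G.exists_isSparse_spanning m hF.le.edgeSet_mono
  obtain ⟨I, hI, hmax⟩ := exists_isAdmissible_maximal hF₀ h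
  obtain hcard | hcard := (hI.sparse.ncard_add_le hne).eq_or_lt
  · exact hI.exists_factor hm hne hF hF₀F hcard
  exfalso
  obtain ⟨S, hSV, hSdeg, hScl⟩ := hI.exists_saturated hmax
  lift S to Finset α using finite_of_subset_vertexSet hSV
  have hJ : G.IsSparse m (G.coreEdges F₀ I S) := hI.sparse.mono (coreEdges_subset hI.subset)
  have hP := isVertexPartition_tightParts hJ
  have hA1 := sum_degree_le hI S hSdeg
  have hA3 := card_mul_sub_le_omega_deleteVerts hm hF hcl hI.sparse hI.subset hScl
  have hA5 := omega_induce_add_le hm hSV hI.sparse hI.subset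
  have hA6 : 2 * ((I \ F₀) ∩ G.edgesIn S).ncard ≤ ∑ v ∈ S, h v :=
    (two_mul_ncard_inter_edgesIn_le hloop hI.sparse.finite.sdiff S).trans
      (Finset.sum_le_sum fun v _ ↦ hI.degree_le v)
  set Q := G.innerParts m (G.coreEdges F₀ I S) S with hQ
  set b := ((I \ F₀) ∩ G.edgesIn S).ncard with hb
  have hQS (C : Set α) (hC : C ∈ Q) : C ⊆ S := (mem_innerParts.1 hC).2
  -- The blocks are disjoint subsets of S and ξ is nonnegative.
  have hξS : ∑ C ∈ Q, ∑ v ∈ S with v ∈ C, ξ v ≤ ∑ v ∈ S, ξ v := by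
    rw [← Finset.sum_biUnion]
    · refine Finset.sum_le_sum_of_subset_of_nonneg
        (Finset.biUnion_subset.2 fun C _ ↦ Finset.filter_subset _ _) fun v hv _ ↦ (hξ v (hSV hv)).1
    · intro C hC D hD hne
      rw [Function.onFun, Finset.disjoint_left]
      intro v hv hv'
      exact Set.disjoint_left.1
        (hP.disjoint (mem_innerParts.1 hC).1 (mem_innerParts.1 hD).1 hne)
        (Finset.mem_filter.1 hv).2 (Finset.mem_filter.1 hv').2
  have hA4 : ∑ C ∈ Q, ((m : ℝ) - (m : ℝ) / (c - 1) * ((C.ncard : ℝ) - 1)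
      - 1 / 2 * (F.boundaryDegree C : ℝ)) ≤ ∑ v ∈ S, ξ v := by
    refine le_trans (Finset.sum_le_sum fun C hC ↦ ?_) hξS
    have hCeq : ((S.filter fun v ↦ v ∈ C : Finset α) : Set α) = C := by
      ext v
      simpa using fun hv ↦ hQS C hC hv
    have := hcomp (S.filter fun v ↦ v ∈ C) (by
      rw [hCeq]
      exact mem_treeComponents_of_mem_tightParts hm hF hF₀F hcl hJ (mem_innerParts.1 hC).1
        (hQS C hC))
    rwa [hCeq, ← Set.ncard_coe_finset, hCeq] at this
  have hT := htough S hSV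
  set ω := (G.induce (S : Set α)).Omega m with hω
  set ω' := (G.deleteVerts (S : Set α)).Omega m with hω'
  rw [Set.ncard_coe_finset] at hA5
  simp only [Finset.sum_sub_distrib, ← Finset.mul_sum, Finset.sum_const, nsmul_eq_mul] at hA4 hA5 hT
  set q : ℝ := ∑ C ∈ Q, (C.ncard : ℝ) - Q.card * 1 with hq
  set d : ℝ := ∑ C ∈ Q, (F.boundaryDegree C : ℝ) with hd
  have hd0 : 0 < c - 1 := by linarith
  have hA1' : ∑ v ∈ S, (h v : ℝ) + (G.coreEdges F₀ I S).ncard ≤ I.ncard + b := by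
    exact_mod_cast hA1
  -- Integrality turns |I| < m|V| - m into the +1 of the hypothesis.
  have hA2' : (I.ncard : ℝ) + m + 1 ≤ m * V(G).ncard := by exact_mod_cast hcard
  have hA3' : 2 * ((m : ℝ) * V(G).ncard - (G.coreEdges F₀ I S).ncard) + d ≤
      2 * ω' + 2 * (m * Q.card) := by
    rw [hd]
    exact_mod_cast hA3
  have hA5' : (ω : ℝ) + (m * q + b) ≤ m * S.card := by
    rw [hq]
    exact_mod_cast hA5
  have hA6' : 2 * (b : ℝ) ≤ ∑ v ∈ S, (h v : ℝ) := by exact_mod_cast hA6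
  have hq0 : 0 ≤ q := by
    rw [hq, mul_one, sub_nonneg]
    calc (Q.card : ℝ) = ∑ C ∈ Q, (1 : ℝ) := by simp
      _ ≤ _ := Finset.sum_le_sum fun C hC ↦ by
        have hC' := hP.nonempty C (mem_innerParts.1 hC).1
        exact_mod_cast (Set.ncard_pos (S.finite_toSet.subset (hQS C hC))).2 hC'
  have hμ : (b : ℝ) ≤ min ((⌊∑ v ∈ S, (h v : ℝ) / 2⌋ : ℤ) : ℝ)
      ((m : ℝ) * (S.card : ℝ) - (ω : ℝ)) := by
    refine le_min ?_ ?_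
    · have : (b : ℤ) ≤ ⌊∑ v ∈ S, (h v : ℝ) / 2⌋ := by
        rw [Int.le_floor, ← Finset.sum_div]
        push_cast
        linarith
      exact_mod_cast this
    · have : 0 ≤ (m : ℝ) * q := by positivity
      linarith
  -- Here c ≥ 2 makes the coefficient nonnegative.
  have hk : (c - 2) / (c - 1) * b ≤ (c - 2) / (c - 1) *
      min ((⌊∑ v ∈ S, (h v : ℝ) / 2⌋ : ℤ) : ℝ) ((m : ℝ) * (S.card : ℝ) - (ω : ℝ)) :=
    mul_le_mul_of_nonneg_left hμ (div_nonneg (by linarith) hd0.le)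
  -- The share 1/(c-1) of b is absorbed by the estimate in G[S], the rest by the minimum.
  have hbsplit : (b : ℝ) = (c - 2) / (c - 1) * b + 1 / (c - 1) * b := by
    field_simp
    ring
  have hA5'' : 1 / (c - 1) * ((ω : ℝ) + (m * q + b)) ≤ 1 / (c - 1) * (m * S.card) :=
    mul_le_mul_of_nonneg_left hA5' (by positivity)
  have e1 : 1 / (c - 1) * ((ω : ℝ) + (m * q + b)) =
      1 / (c - 1) * ω + m / (c - 1) * q + 1 / (c - 1) * b := by ring
  have e2 : 1 / (c - 1) * ((m : ℝ) * S.card) = S.card * (m / (c - 1)) := by ring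
  rw [e1, e2] at hA5''
  linarith
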